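/- Let $K$ be an algebraically closed field and $A$ a finite-dimensional $K$-algebra. Modules are finite-dimensional left modules, $A^{\mathrm{op}}$ is the opposite algebra, $D=\operatorname{Hom}_K(-,K)$ is the standard duality, and $(-)^*=\operatorname{Hom}_A(-,{}_AA)$. For a module $M$ with minimal projective presentation $P_1\to P_0\to M\to 0$, the transpose is $\operatorname{Tr}M=\operatorname{coker}(P_0^*\to P_1^*)$. Put $\tau=D\operatorname{Tr}$, $\tau^-=\operatorname{Tr}D$, $\nu=D(-)^*$ and $\nu^-=(D-)^*$. Write $\#M$ for the number of isomorphism classes of indecomposable direct summands of $M$, and $\#A$ for the number of isomorphism classes of simple $A$-modules. A module is basic if no two distinct indecomposable summands in a decomposition are isomorphic. A pair $(T,P)$ of $A$-modules is a $\tau$-rigid pair if $\operatorname{Hom}_A(T,\tau T)=0$, $P$ is projective and $\operatorname{Hom}_A(P,T)=0$; it is a support $\tau$-tilting pair if moreover $\#T+\#P=\#A$. A pair $(U,I)$ is a $\tau^-$-rigid pair if $\operatorname{Hom}_A(\tau^-U,U)=0$, $I$ is injective and $\operatorname{Hom}_A(U,I)=0$; it is a support $\tau^-$-tilting pair if moreover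 $\#U+\#I=\#A$. A pair is basic if both components are. Let $\tau\text{-rigid}\,A$, $s\tau\text{-tilt}\,A$, $\tau^-\text{-rigid}\,A$ and $s\tau^-\text{-tilt}\,A$ be the sets of isomorphism classes of basic pairs of the respective kinds. For a module $T$ write $T=T_{\mathrm{pr}}\oplus T_{\mathrm{np}}$ with $T_{\mathrm{pr}}$ a maximal projective summand, so that $T_{\mathrm{np}}$ has no nonzero projective summand; dually write $Y=Y_{\mathrm{in}}\oplus Y_{\mathrm{ni}}$ with $Y_{\mathrm{in}}$ a maximal injective summand. For a $\tau$-rigid pair $(T,P)$ put $$(T,P)^\dagger:=(\operatorname{Tr}T_{\mathrm{np}}\oplus P^*,\;T_{\mathrm{pr}}^*)\cong(\operatorname{Tr}T\oplus P^*,\;T_{\mathrm{pr}}^*).$$ (1) The assignment $(-)^\dagger$ induces bijections $\tau\text{-rigid}\,A\leftrightarrow\tau\text{-rigid}\,A^{\mathrm{op}}$ and $s\tau\text{-tilt}\,A\leftrightarrow s\tau\text{-tilt}\,A^{\mathrm{op}}$ such that $(-)^{\dagger\dagger}=\mathrm{id}$, where $(A^{\mathrm{op}})^{\mathrm{op}}$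 is identified with $A$. (2) Composing with $D$ gives bijections $\tau\text{-rigid}\,A\leftrightarrow\tau^-\text{-rigid}\,A$ and $s\tau\text{-tilt}\,A\leftrightarrow s\tau^-\text{-tilt}\,A$, namely $$(X,P)\longmapsto D\big((X,P)^\dagger\big)\cong(\tau X\oplus\nu P,\;\nu X_{\mathrm{pr}}),$$ with inverse $$(Y,I)\longmapsto\big(D(Y,I)\big)^\dagger\cong(\tau^-Y\oplus\nu^-I,\;\nu^-Y_{\mathrm{in}}).$$ -/

import Mathlib

open MulOpposite

universe u

namespace TauTilting

section Modules

variable (K : Type u) (A : Type u) [Field K] [Ring A] [Algebra K A]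

/-- A finite-dimensional left module over the `K`-algebra `A`. Right `A`-modules are left modules
over `Aᵐᵒᵖ`. -/
structure FDMod : Type (u + 1) where
  carrier : Type u
  [addCommGroup : AddCommGroup carrier]
  [moduleField : Module K carrier]
  [module : Module A carrier]
  [isScalarTower : IsScalarTower K A carrier]
  [finite : Module.Finite K carrier]

instance : CoeSort (FDMod K A) (Type u) := ⟨FDMod.carrier⟩

attribute [instance] FDMod.addCommGroup FDMod.moduleField FDMod.module FDMod.isScalarTower
  FDMod.finite

end Modules

variable {K : Type u} {A : Type u} [Field K] [Ring A] [Algebra K A]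

namespace FDMod

/-- Isomorphism of `A`-modules. -/
def Iso (M N : FDMod K A) : Prop := Nonempty (M ≃ₗ[A] N)

/-- The direct sum `M ⊕ N`. -/
def sum (M N : FDMod K A) : FDMod K A where
  carrier := M × N

variable (K A) in
/-- The zero module. -/
def zero : FDMod K A where
  carrier := PUnit.{u + 1}

/-- A submodule of a finite-dimensional module. -/
def ofSubmodule (M : FDMod K A) (N : Submodule A M) : FDMod K A where
  carrier := N
  finite := inferInstanceAs (Module.Finite K (N.restrictScalars K))

/-- A quotient of a finite-dimensional module. -/
def quotient (M : FDMod K A) (N : Submodule A M) : FDMod K A where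
  carrier := M ⧸ N
  finite := inferInstanceAs (Module.Finite K (M ⧸ N.restrictScalars K))

/-- The relation of being isomorphic, as a setoid. -/
def isoSetoid (K A : Type u) [Field K] [Ring A] [Algebra K A] : Setoid (FDMod K A) where
  r := Iso
  iseqv := ⟨fun _ => ⟨LinearEquiv.refl _ _⟩, fun ⟨e⟩ => ⟨e.symm⟩, fun ⟨e⟩ ⟨f⟩ => ⟨e.trans f⟩⟩

/-- Isomorphism classes of finite-dimensional `A`-modules. -/
abbrev IsoClass (K A : Type u) [Field K] [Ring A] [Algebra K A] : Type (u + 1) :=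
  Quotient (isoSetoid K A)

/-- The isomorphism class of a module. -/
def cls (M : FDMod K A) : IsoClass K A := Quotient.mk (isoSetoid K A) M

/-- `X` is isomorphic to a direct summand of `M`. -/
def IsSummand (X M : FDMod K A) : Prop := ∃ Y : FDMod K A, Iso M (X.sum Y)

/-- `X` is nonzero and is not a direct sum of two nonzero modules. -/
def IsIndecomposable (X : FDMod K A) : Prop :=
  Nontrivial X ∧ ∀ Y Z : FDMod K A, Iso X (Y.sum Z) → Subsingleton Y ∨ Subsingleton Z

/-- `# M`: the number of isomorphism classes of indecomposable summands of `M`. -/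
noncomputable def numSummands (M : FDMod K A) : ℕ∞ :=
  Set.encard {c : IsoClass K A | ∃ X : FDMod K A, X.IsIndecomposable ∧ X.IsSummand M ∧ X.cls = c}

/-- `M` is basic: in any decomposition, two distinct indecomposable summands are not
isomorphic. -/
def IsBasic (M : FDMod K A) : Prop :=
  ∀ X Y Z : FDMod K A, X.IsIndecomposable → Y.IsIndecomposable → Iso M ((X.sum Y).sum Z) →
    ¬ Iso X Y

/-- `T = T_pr ⊕ T_np`, where `T_pr` is projective and `T_np` has no nonzero projective direct
summand, that is, `T_pr` is a maximal projective summand of `T`. -/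
def IsProjDecomp (T Tpr Tnp : FDMod K A) : Prop :=
  Iso T (Tpr.sum Tnp) ∧ Module.Projective A Tpr ∧
    ∀ Q : FDMod K A, Module.Projective A Q → Q.IsSummand Tnp → Subsingleton Q

/-- `Y = Y_in ⊕ Y_ni`, where `Y_in` is injective and `Y_ni` has no nonzero injective direct
summand, that is, `Y_in` is a maximal injective summand of `Y`. -/
def IsInjDecomp (Y Yin Yni : FDMod K A) : Prop :=
  Iso Y (Yin.sum Yni) ∧ Module.Injective A Yin ∧
    ∀ J : FDMod K A, Module.Injective A J → J.IsSummand Yni → Subsingleton J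

/-- An `(Aᵒᵖ)ᵒᵖ`-module, regarded as an `A`-module. -/
def ofOpOp (M : FDMod K Aᵐᵒᵖᵐᵒᵖ) : FDMod K A :=
  letI : Module A M := Module.compHom M (RingEquiv.opOp A).toRingHom
  { carrier := M
    isScalarTower := ⟨fun k a x => smul_assoc k (op (op a)) x⟩ }

/-- The right `A`-module structure on the `K`-dual of a left `A`-module:
`(φ a) x = φ (a x)`. -/
@[reducible]
def dualModule (M : FDMod K A) : Module Aᵐᵒᵖ (Module.Dual K M) where
  smul a φ := φ ∘ₗ Algebra.lsmul K K M a.unop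
  one_smul φ := by ext x; exact congrArg φ (one_smul A x)
  mul_smul a b φ := by ext x; exact congrArg φ (mul_smul b.unop a.unop x)
  smul_zero a := rfl
  smul_add a φ ψ := rfl
  add_smul a b φ := by
    ext x
    exact (congrArg φ (add_smul a.unop b.unop x)).trans (map_add φ _ _)
  zero_smul φ := by
    ext x
    exact (congrArg φ (zero_smul A x)).trans (map_zero φ)

/-- The standard duality `D M = Hom_K(M, K)`. -/
def dual (M : FDMod K A) : FDMod K Aᵐᵒᵖ :=
  letI := dualModule M
  { carrier := Module.Dual K M
    isScalarTower := ⟨fun k a φ => by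
      ext x
      exact (congrArg φ (smul_assoc k a.unop x)).trans (map_smul φ k _)⟩ }

section Star

variable [Module.Finite K A]

/-- `M* = Hom_A(M, A)`, with the right `A`-module structure `(f a) x = (f x) a`. -/
def star (M : FDMod K A) : FDMod K Aᵐᵒᵖ where
  carrier := M →ₗ[A] A
  isScalarTower := ⟨fun k a f => by
    ext x
    exact smul_assoc k a (f x)⟩
  finite := Module.Finite.of_injective (LinearMap.restrictScalarsₗ K A M A K)
    (LinearMap.restrictScalars_injective K)

/-- `f* : N* → M*`, precomposition with `f : M → N`. -/
def starMap {M N : FDMod K A} (f : M →ₗ[A] N) : N.star →ₗ[Aᵐᵒᵖ] M.star where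
  toFun g := LinearMap.comp (show N →ₗ[A] A from g) f
  map_add' _ _ := rfl
  map_smul' _ _ := rfl

end Star

/-- A minimal projective presentation `P₁ → P₀ → M → 0`: an exact sequence with `P₀`, `P₁`
projective in which the kernels of `P₀ → M` and of `P₁ → P₀` are superfluous submodules. -/
structure MinProjPres (M : FDMod K A) : Type (u + 1) where
  P₁ : FDMod K A
  P₀ : FDMod K A
  projective₁ : Module.Projective A P₁
  projective₀ : Module.Projective A P₀
  d : P₁ →ₗ[A] P₀
  π : P₀ →ₗ[A] M
  surjective : Function.Surjective π
  exact : Function.Exact d π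
  minimal₀ : ∀ N : Submodule A P₀, N ⊔ LinearMap.ker π = ⊤ → N = ⊤
  minimal₁ : ∀ N : Submodule A P₁, N ⊔ LinearMap.ker d = ⊤ → N = ⊤

section Existence

theorem isoRefl (M : FDMod K A) : Iso M M := ⟨LinearEquiv.refl _ _⟩

/-- Every module has a decomposition `T = T_pr ⊕ T_np` as above. -/
theorem exists_isProjDecomp (T : FDMod K A) : ∃ Tpr Tnp : FDMod K A, IsProjDecomp T Tpr Tnp := by
  induction hn : Module.finrank K T using Nat.strong_induction_on generalizing T with
  | _ n ih =>
    by_cases h : ∀ Q : FDMod K A, Module.Projective A Q → Q.IsSummand T → Subsingleton Q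
    · refine ⟨zero K A, T, ⟨?_⟩, ?_, h⟩
      · exact (LinearEquiv.uniqueProd (R := A) (M := T) (M₂ := PUnit.{u + 1})).symm
      · exact (inferInstance : Module.Projective A PUnit.{u + 1})
    · push Not at h
      obtain ⟨Q, hQ, ⟨Y, ⟨e⟩⟩, hQn⟩ := h
      have hlt : Module.finrank K Y < n := by
        have h1 : Module.finrank K T = Module.finrank K (Q × Y) :=
          (e.restrictScalars K).finrank_eq
        have h2 : 0 < Module.finrank K Q := by
          have := hQn
          exact Module.finrank_pos
        rw [Module.finrank_prod] at h1
        omega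
      obtain ⟨R, S, ⟨e'⟩, hR, hS⟩ := ih _ hlt Y rfl
      refine ⟨Q.sum R, S, ⟨?_⟩, ?_, hS⟩
      · exact e.trans (((LinearEquiv.refl A Q).prodCongr e').trans
          (LinearEquiv.prodAssoc A Q R S).symm)
      · exact (inferInstance : Module.Projective A (Q × R))

/-- Every module has a decomposition `Y = Y_in ⊕ Y_ni` as above. -/
theorem exists_isInjDecomp (Y : FDMod K A) : ∃ Yin Yni : FDMod K A, IsInjDecomp Y Yin Yni := by
  induction hn : Module.finrank K Y using Nat.strong_induction_on generalizing Y with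
  | _ n ih =>
    by_cases h : ∀ Q : FDMod K A, Module.Injective A Q → Q.IsSummand Y → Subsingleton Q
    · refine ⟨zero K A, Y, ⟨?_⟩, ?_, h⟩
      · exact (LinearEquiv.uniqueProd (R := A) (M := Y) (M₂ := PUnit.{u + 1})).symm
      · exact ⟨fun X Y _ _ _ _ f hf g => ⟨0, fun x => Subsingleton.elim (α := PUnit) _ _⟩⟩
    · push Not at h
      obtain ⟨Q, hQ, ⟨Z, ⟨e⟩⟩, hQn⟩ := h
      have hlt : Module.finrank K Z < n := by
        have h1 : Module.finrank K Y = Module.finrank K (Q × Z) :=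
          (e.restrictScalars K).finrank_eq
        have h2 : 0 < Module.finrank K Q := by
          have := hQn
          exact Module.finrank_pos
        rw [Module.finrank_prod] at h1
        omega
      obtain ⟨R, S, ⟨e'⟩, hR, hS⟩ := ih _ hlt Z rfl
      refine ⟨Q.sum R, S, ⟨?_⟩, ?_, hS⟩
      · exact e.trans (((LinearEquiv.refl A Q).prodCongr e').trans
          (LinearEquiv.prodAssoc A Q R S).symm)
      · refine ⟨fun X Y _ _ _ _ f hf g => ?_⟩
        obtain ⟨g₁, h₁⟩ := hQ.out f hf ((LinearMap.fst A Q R).comp g)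
        obtain ⟨g₂, h₂⟩ := hR.out f hf ((LinearMap.snd A Q R).comp g)
        exact ⟨g₁.prod g₂, fun x => Prod.ext (h₁ x) (h₂ x)⟩

variable [Module.Finite K A]

/-- Every module has a projective cover. -/
theorem exists_projCover (M : FDMod K A) : ∃ (P : FDMod K A) (π : P →ₗ[A] M),
    Module.Projective A P ∧ Function.Surjective π ∧
      ∀ N : Submodule A P, N ⊔ LinearMap.ker π = ⊤ → N = ⊤ := by
  classical
  have hex : ∃ n : ℕ, ∃ (P : FDMod K A) (π : P →ₗ[A] M),
      Module.Projective A P ∧ Function.Surjective π ∧ Module.finrank K P = n := by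
    have : Module.Finite A M := Module.Finite.of_restrictScalars_finite K A M
    obtain ⟨n, f, hf⟩ := Module.Finite.exists_fin' A M
    exact ⟨_, { carrier := Fin n → A }, f,
      (inferInstance : Module.Projective A (Fin n → A)), hf, rfl⟩
  obtain ⟨P, π, hP, hπ, hn⟩ := Nat.find_spec hex
  refine ⟨P, π, hP, hπ, fun N hN => ?_⟩
  have hNsurj : Function.Surjective (π.comp N.subtype) := by
    intro m
    obtain ⟨p, rfl⟩ := hπ m
    have hp : p ∈ N ⊔ LinearMap.ker π := hN ▸ Submodule.mem_top
    obtain ⟨y, hy, z, hz, rfl⟩ := Submodule.mem_sup.1 hp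
    refine ⟨⟨y, hy⟩, ?_⟩
    have : π z = 0 := hz
    simp [this]
  obtain ⟨g, hg⟩ := Module.projective_lifting_property (π.comp N.subtype) π hNsurj
  set f : P →ₗ[A] P := N.subtype.comp g with hfdef
  have hπf : ∀ x, π (f x) = π x := fun x => LinearMap.congr_fun hg x
  have hπfk : ∀ k x, π ((f ^ k) x) = π x := by
    intro k
    induction k with
    | zero => intro x; simp
    | succ k ih => intro x; rw [pow_succ', Module.End.mul_apply, hπf, ih]
  have : IsArtinian A P := isArtinian_of_tower K inferInstance
  have : IsNoetherian A P := isNoetherian_of_tower K inferInstance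
  obtain ⟨k, hk, hk1⟩ := (LinearMap.eventually_isCompl_ker_pow_range_pow (R := A) (M := P) f).and
    (Filter.eventually_ge_atTop 1) |>.exists
  have hR : Module.Projective A (LinearMap.range (f ^ k)) :=
    Module.Projective.of_split (Submodule.subtype _)
      (Submodule.projectionOnto _ _ hk.symm) (by
        ext x
        exact congrArg Subtype.val (Submodule.projectionOnto_apply_left hk.symm x))
  have hmin : Nat.find hex ≤ Module.finrank K (P.ofSubmodule (LinearMap.range (f ^ k))) :=
    Nat.find_min' hex ⟨P.ofSubmodule (LinearMap.range (f ^ k)),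
      π.comp (Submodule.subtype _), hR, by
        intro m
        obtain ⟨p, rfl⟩ := hπ m
        exact ⟨⟨(f ^ k) p, ⟨p, rfl⟩⟩, hπfk k p⟩, rfl⟩
  rw [← hn] at hmin
  have htop : (LinearMap.range (f ^ k)).restrictScalars K = ⊤ :=
    Submodule.eq_top_of_finrank_eq (le_antisymm (Submodule.finrank_le _) hmin)
  have hsurj : Function.Surjective (f ^ k) := by
    intro x
    have : x ∈ (LinearMap.range (f ^ k)).restrictScalars K := htop ▸ Submodule.mem_top
    exact this
  have hgz : Function.Surjective f := by
    obtain ⟨j, rfl⟩ : ∃ j, k = j + 1 := ⟨k - 1, by omega⟩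
    intro x
    obtain ⟨y, hy⟩ := hsurj x
    exact ⟨(f ^ j) y, by rw [← hy, pow_succ', Module.End.mul_apply]⟩
  rw [eq_top_iff]
  intro x _
  obtain ⟨y, rfl⟩ := hgz x
  exact (g y).2

/-- Every module has a minimal projective presentation. -/
theorem nonempty_minProjPres (M : FDMod K A) : Nonempty (MinProjPres M) := by
  obtain ⟨P₀, π, h₀, hπ, hm₀⟩ := exists_projCover M
  obtain ⟨P₁, ρ, h₁, hρ, hm₁⟩ := exists_projCover (P₀.ofSubmodule (LinearMap.ker π))
  let ι : P₀.ofSubmodule (LinearMap.ker π) →ₗ[A] P₀ := (LinearMap.ker π).subtype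
  have hι : Function.Injective ι := Subtype.val_injective
  refine ⟨⟨P₁, P₀, h₁, h₀, ι.comp ρ, π, hπ, ?_, hm₀, ?_⟩⟩
  · intro x
    constructor
    · intro hx
      obtain ⟨y, hy⟩ := hρ ⟨x, hx⟩
      exact ⟨y, by rw [LinearMap.comp_apply, hy]; rfl⟩
    · rintro ⟨y, rfl⟩
      exact (ρ y).2
  · intro N hN
    apply hm₁
    rwa [LinearMap.ker_comp, LinearMap.ker_eq_bot.2 hι, Submodule.comap_bot] at hN

end Existence

section Transpose

variable [Module.Finite K A]

/-- The cokernel of `P₀* → P₁*`, for a minimal projective presentation `P₁ → P₀ → M → 0`. -/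
def MinProjPres.transpose {M : FDMod K A} (p : MinProjPres M) : FDMod K Aᵐᵒᵖ :=
  p.P₁.star.quotient (LinearMap.range (starMap p.d))

/-- The transpose `Tr M`, an `Aᵒᵖ`-module. -/
noncomputable def tr (M : FDMod K A) : FDMod K Aᵐᵒᵖ :=
  (Classical.choice (nonempty_minProjPres M)).transpose

/-- The Auslander–Reiten translate `τ = D Tr`. -/
noncomputable def tau (M : FDMod K A) : FDMod K A := ofOpOp M.tr.dual

/-- The inverse Auslander–Reiten translate `τ⁻ = Tr D`. -/
noncomputable def tauMinus (M : FDMod K A) : FDMod K A := ofOpOp M.dual.tr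

/-- The Nakayama functor `ν = D Hom_A(-, A)`. -/
def nu (M : FDMod K A) : FDMod K A := ofOpOp M.star.dual

/-- The inverse Nakayama functor `ν⁻ = Hom_{Aᵒᵖ}(D -, A)`. -/
def nuMinus (M : FDMod K A) : FDMod K A := ofOpOp M.dual.star

/-- `M` is `τ`-rigid: `Hom_A(M, τ M) = 0`. -/
def IsTauRigid (M : FDMod K A) : Prop := ∀ f : M →ₗ[A] M.tau, f = 0

/-- `M` is `τ⁻`-rigid: `Hom_A(τ⁻ M, M) = 0`. -/
def IsTauMinusRigid (M : FDMod K A) : Prop := ∀ f : M.tauMinus →ₗ[A] M, f = 0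

end Transpose

end FDMod

/-- `# A`: the number of isomorphism classes of simple `A`-modules, that is, the number of
vertices of the quiver of `A`. -/
noncomputable def numVertices (K A : Type u) [Field K] [Ring A] [Algebra K A] : ℕ∞ :=
  Set.encard {c : FDMod.IsoClass K A | ∃ S : FDMod K A, IsSimpleModule A S ∧ S.cls = c}

/-- A pair of finite-dimensional `A`-modules. -/
structure ModPair (K A : Type u) [Field K] [Ring A] [Algebra K A] : Type (u + 1) where
  fst : FDMod K A
  snd : FDMod K A

namespace ModPair

/-- Isomorphism of pairs, as a setoid. -/
def isoSetoid (K A : Type u) [Field K] [Ring A] [Algebra K A] : Setoid (ModPair K A) where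
  r X Y := X.fst.Iso Y.fst ∧ X.snd.Iso Y.snd
  iseqv := ⟨fun _ => ⟨⟨LinearEquiv.refl _ _⟩, ⟨LinearEquiv.refl _ _⟩⟩,
    fun ⟨⟨e⟩, ⟨f⟩⟩ => ⟨⟨e.symm⟩, ⟨f.symm⟩⟩,
    fun ⟨⟨e⟩, ⟨f⟩⟩ ⟨⟨e'⟩, ⟨f'⟩⟩ => ⟨⟨e.trans e'⟩, ⟨f.trans f'⟩⟩⟩

/-- Isomorphism classes of pairs of modules. -/
abbrev IsoClass (K A : Type u) [Field K] [Ring A] [Algebra K A] : Type (u + 1) :=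
  Quotient (isoSetoid K A)

/-- The isomorphism class of a pair. -/
def cls (X : ModPair K A) : IsoClass K A := Quotient.mk (isoSetoid K A) X

/-- An `(Aᵒᵖ)ᵒᵖ`-pair, regarded as an `A`-pair. -/
def ofOpOp (X : ModPair K Aᵐᵒᵖᵐᵒᵖ) : ModPair K A := ⟨X.fst.ofOpOp, X.snd.ofOpOp⟩

/-- The standard duality, applied to both components. -/
def dual (X : ModPair K A) : ModPair K Aᵐᵒᵖ := ⟨X.fst.dual, X.snd.dual⟩

/-- Both components are basic. -/
def IsBasic (X : ModPair K A) : Prop := X.fst.IsBasic ∧ X.snd.IsBasic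

variable [Module.Finite K A]

/-- `(T, P)` is a `τ`-rigid pair. -/
def IsTauRigid (X : ModPair K A) : Prop :=
  X.fst.IsTauRigid ∧ Module.Projective A X.snd ∧ ∀ f : X.snd →ₗ[A] X.fst, f = 0

/-- `(T, P)` is a support `τ`-tilting pair. -/
def IsSupportTauTilting (X : ModPair K A) : Prop :=
  X.IsTauRigid ∧ X.fst.numSummands + X.snd.numSummands = numVertices K A

/-- `(U, I)` is a `τ⁻`-rigid pair. -/
def IsTauMinusRigid (X : ModPair K A) : Prop :=
  X.fst.IsTauMinusRigid ∧ Module.Injective A X.snd ∧ ∀ f : X.fst →ₗ[A] X.snd, f = 0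

/-- `(U, I)` is a support `τ⁻`-tilting pair. -/
def IsSupportTauMinusTilting (X : ModPair K A) : Prop :=
  X.IsTauMinusRigid ∧ X.fst.numSummands + X.snd.numSummands = numVertices K A

end ModPair

section Classes

variable (K A : Type u) [Field K] [Ring A] [Algebra K A] [Module.Finite K A]

/-- Isomorphism classes of basic `τ`-rigid pairs. -/
def tauRigidClasses : Set (ModPair.IsoClass K A) :=
  {c | ∃ X : ModPair K A, X.IsBasic ∧ X.IsTauRigid ∧ X.cls = c}

/-- Isomorphism classes of basic support `τ`-tilting pairs. -/
def supportTauTiltingClasses : Set (ModPair.IsoClass K A) :=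
  {c | ∃ X : ModPair K A, X.IsBasic ∧ X.IsSupportTauTilting ∧ X.cls = c}

/-- Isomorphism classes of basic `τ⁻`-rigid pairs. -/
def tauMinusRigidClasses : Set (ModPair.IsoClass K A) :=
  {c | ∃ X : ModPair K A, X.IsBasic ∧ X.IsTauMinusRigid ∧ X.cls = c}

/-- Isomorphism classes of basic support `τ⁻`-tilting pairs. -/
def supportTauMinusTiltingClasses : Set (ModPair.IsoClass K A) :=
  {c | ∃ X : ModPair K A, X.IsBasic ∧ X.IsSupportTauMinusTilting ∧ X.cls = c}

end Classes

end TauTilting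

open TauTilting

/-!
The bijection rests on three facts about `(T, P)† = (Tr T ⊕ P*, T_pr*)`: it is an involution up to
isomorphism, it preserves the conditions on pairs, and it is well defined on isomorphism classes.

*Involution.* For a map `d` between projective modules, call `d` radical, right minimal or left
minimal according to which endomorphisms `1 - d g`, `h` with `d h = d`, or `h` with `h d = d` are
forced to be invertible. A presentation `d : P₁ → P₀` of `M` is minimal exactly when `d` is radical
and right minimal (`isRadical_iff`, `isRightMinimal_iff`), and `M` has no nonzero projective summand
exactly when `d` is left minimal (`isLeftMinimal_iff`, by Fitting's lemma). On projective modules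
`(-)*` is a duality (via dual bases), so it preserves radical maps and exchanges left and right
minimality. Hence `Tr M` never has projective summands, and `P₀* → P₁*` is a minimal presentation
of `Tr M` if `M` has none, so that `Tr Tr M ≅ M` (`tr_tr_iso`). Together with `P** ≅ P` this gives
`ModPair.dagger_dagger_iso`.

*Rigidity.* `Hom_A(M, D N)` and `Hom_{Aᵒᵖ}(N, D M)` are the same space of balanced bilinear forms
(`HomZero.flip`), and for projective `P` the conditions `Hom(P, D N) = 0` and `Hom(P*, N) = 0` both
say that the trace ideal of `P` annihilates `N` (`HomZero.star_left`). Since `τ Tr T ≅ D T_np`, the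
vanishing conditions for `(T, P)†` follow from those for `(T, P)` (`ModPair.IsTauRigid.dagger`).
Only this implication is needed, because `(-)†` is an involution.

*Counting and basicness.* The exchange property of indecomposable modules
(`IsIndecomposable.exchange`) makes the maximal projective summand unique and lets summands of
`T_np ⊕ T_pr` be counted separately. The operations `Tr`, `(-)*` and `D` are additive and invertible
on suitable classes of modules, which is all that is needed to transfer indecomposable summands
(`SummandCorrespondence`).

The second bijection is the first followed by `D`: a pair is `τ⁻`-rigid exactly when its dual is
`τ`-rigid (`ModPair.isTauRigid_dual_iff`), as injective modules are dual to projective ones and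
`τ D U ≅ D τ⁻ U`.
-/


namespace TauTilting

variable {K : Type u} {A : Type u} [Field K] [Ring A] [Algebra K A]

namespace FDMod

/-! ### Isomorphisms, direct sums and summands -/

theorem Iso.symm {M N : FDMod K A} : M.Iso N → N.Iso M := fun ⟨e⟩ => ⟨e.symm⟩

theorem Iso.trans {L M N : FDMod K A} : L.Iso M → M.Iso N → L.Iso N :=
  fun ⟨e⟩ ⟨f⟩ => ⟨e.trans f⟩

theorem Iso.sum {M M' N N' : FDMod K A} : M.Iso M' → N.Iso N' → (M.sum N).Iso (M'.sum N') :=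
  fun ⟨e⟩ ⟨f⟩ => ⟨e.prodCongr f⟩

theorem sumComm (M N : FDMod K A) : (M.sum N).Iso (N.sum M) := ⟨LinearEquiv.prodComm A M N⟩

theorem sumAssoc (L M N : FDMod K A) : ((L.sum M).sum N).Iso (L.sum (M.sum N)) :=
  ⟨LinearEquiv.prodAssoc A L M N⟩

theorem Iso.subsingleton {M N : FDMod K A} : M.Iso N → Subsingleton M → Subsingleton N :=
  fun ⟨e⟩ _ => e.symm.toEquiv.subsingleton

theorem Iso.projective {M N : FDMod K A} :
    M.Iso N → Module.Projective A M → Module.Projective A N :=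
  fun ⟨e⟩ _ => Module.Projective.of_equiv' e

theorem Iso.finrank_eq {M N : FDMod K A} : M.Iso N → Module.finrank K M = Module.finrank K N :=
  fun ⟨e⟩ => (e.restrictScalars K).finrank_eq

theorem finrank_sum (M N : FDMod K A) :
    Module.finrank K (M.sum N) = Module.finrank K M + Module.finrank K N :=
  Module.finrank_prod (R := K) (M := M) (M' := N)

theorem iso_of_subsingleton {M N : FDMod K A} (hM : Subsingleton M) (hN : Subsingleton N) :
    M.Iso N := ⟨⟨0, 0, fun _ => Subsingleton.elim _ _, fun _ => Subsingleton.elim _ _⟩⟩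

theorem sum_iso_right (M N : FDMod K A) (hM : Subsingleton M) : (M.sum N).Iso N :=
  ⟨{ LinearMap.snd A M N with
      invFun := fun n => (0, n)
      left_inv := fun _ => Prod.ext (hM.elim _ _) rfl
      right_inv := fun _ => rfl }⟩

theorem sum_iso_left (M N : FDMod K A) (hN : Subsingleton N) : (M.sum N).Iso M :=
  (sumComm M N).trans (sum_iso_right N M hN)

/-- A module isomorphic to its own square is zero. -/
theorem subsingleton_of_iso_sum_self {M : FDMod K A} (h : M.Iso (M.sum M)) : Subsingleton M := by
  have h1 := h.finrank_eq
  rw [finrank_sum] at h1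
  exact Module.finrank_zero_iff (R := K).1 (by omega)

theorem iso_sum_self {M : FDMod K A} (h : Subsingleton M) : M.Iso (M.sum M) :=
  (sum_iso_left M M h).symm

theorem IsSummand.iso {X Y M : FDMod K A} (h : X.IsSummand M) (e : X.Iso Y) : Y.IsSummand M :=
  let ⟨Z, hZ⟩ := h; ⟨Z, hZ.trans (e.sum (isoRefl Z))⟩

theorem IsSummand.iso_right {X M N : FDMod K A} (h : X.IsSummand M) (e : M.Iso N) :
    X.IsSummand N :=
  let ⟨Z, hZ⟩ := h; ⟨Z, e.symm.trans hZ⟩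

theorem IsSummand.trans {X M N : FDMod K A} (h : X.IsSummand M) (h' : M.IsSummand N) :
    X.IsSummand N :=
  let ⟨Y, hY⟩ := h
  let ⟨Z, hZ⟩ := h'
  ⟨Y.sum Z, hZ.trans ((hY.sum (isoRefl Z)).trans (sumAssoc X Y Z))⟩

theorem isSummand_sum_left (M N : FDMod K A) : M.IsSummand (M.sum N) := ⟨N, isoRefl _⟩

theorem isSummand_sum_right (M N : FDMod K A) : N.IsSummand (M.sum N) := ⟨M, sumComm M N⟩

theorem IsSummand.projective {X M : FDMod K A} :
    X.IsSummand M → Module.Projective A M → Module.Projective A X := by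
  rintro ⟨Y, h⟩ _
  obtain ⟨e⟩ : Nonempty (M ≃ₗ[A] (X × Y)) := h
  refine Module.Projective.of_split (e.symm.toLinearMap.comp (LinearMap.inl A X Y))
    ((LinearMap.fst A X Y).comp e.toLinearMap) ?_
  ext x
  simp

theorem projective_sum {M N : FDMod K A} (_ : Module.Projective A M)
    (_ : Module.Projective A N) : Module.Projective A (M.sum N) :=
  inferInstanceAs (Module.Projective A (M × N))

theorem IsBasic.iso {M N : FDMod K A} (h : M.IsBasic) (e : M.Iso N) : N.IsBasic :=
  fun X Y Z hX hY hN => h X Y Z hX hY (e.trans hN)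

theorem IsBasic.summand {M N : FDMod K A} (h : M.IsBasic) (hN : N.IsSummand M) : N.IsBasic := by
  obtain ⟨W, hW⟩ := hN
  exact fun X Y Z hX hY hN => h X Y (Z.sum W) hX hY
    (hW.trans ((hN.sum (isoRefl W)).trans (sumAssoc _ Z W)))

theorem numSummands_congr {M N : FDMod K A} (e : M.Iso N) : M.numSummands = N.numSummands := by
  unfold numSummands
  congr 1
  ext c
  exact ⟨fun ⟨X, h, h', hc⟩ => ⟨X, h, h'.iso_right e, hc⟩,
    fun ⟨X, h, h', hc⟩ => ⟨X, h, h'.iso_right e.symm, hc⟩⟩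

theorem exists_indecomposable_summand (M : FDMod K A) (hM : Nontrivial M) :
    ∃ X Y : FDMod K A, X.IsIndecomposable ∧ M.Iso (X.sum Y) := by
  induction hn : Module.finrank K M using Nat.strong_induction_on generalizing M with
  | _ n ih =>
    by_cases h : M.IsIndecomposable
    · exact ⟨M, zero K A, h, (sum_iso_left M _ (inferInstanceAs (Subsingleton PUnit))).symm⟩
    · obtain ⟨Y, Z, e, hY, hZ⟩ : ∃ Y Z : FDMod K A, M.Iso (Y.sum Z) ∧ Nontrivial Y ∧
          Nontrivial Z := by
        simpa [IsIndecomposable, hM, not_or, not_subsingleton_iff_nontrivial] using h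
      have h1 := e.finrank_eq
      rw [finrank_sum] at h1
      have h2 : 0 < Module.finrank K Z := Module.finrank_pos
      obtain ⟨X, W, hX, e'⟩ := ih _ (by omega) Y hY rfl
      exact ⟨X, W.sum Z, hX, e.trans ((e'.sum (isoRefl Z)).trans (sumAssoc X W Z))⟩

/-! ### Exchange and cancellation -/

/-- Surjective and injective endomorphisms of a finite-dimensional module coincide. -/
theorem bijective_of_surjective {M : FDMod K A} {f : M →ₗ[A] M} (h : Function.Surjective f) :
    Function.Bijective f :=
  ⟨(LinearMap.injective_iff_surjective (f := f.restrictScalars K)).2 h, h⟩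

theorem bijective_of_injective {M : FDMod K A} {f : M →ₗ[A] M} (h : Function.Injective f) :
    Function.Bijective f :=
  ⟨h, (LinearMap.injective_iff_surjective (f := f.restrictScalars K)).1 h⟩

theorem iso_of_isCompl {M : FDMod K A} {p q : Submodule A M} (h : IsCompl p q) :
    M.Iso ((M.ofSubmodule p).sum (M.ofSubmodule q)) :=
  ⟨(Submodule.prodEquivOfIsCompl p q h).symm⟩

/-- Fitting's lemma: `M` is the direct sum of the kernel and the range of a power of any
endomorphism. -/
theorem exists_isCompl_ker_pow_range_pow {M : FDMod K A} (f : M →ₗ[A] M) :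
    ∃ k, 1 ≤ k ∧ IsCompl (LinearMap.ker (f ^ k)) (LinearMap.range (f ^ k)) := by
  have : IsArtinian A M := isArtinian_of_tower K inferInstance
  have : IsNoetherian A M := isNoetherian_of_tower K inferInstance
  obtain ⟨k, hk, hk1⟩ := (LinearMap.eventually_isCompl_ker_pow_range_pow (R := A) (M := M) f).and
    (Filter.eventually_ge_atTop 1) |>.exists
  exact ⟨k, hk1, hk⟩

/-- The endomorphism ring of an indecomposable module is local. -/
theorem IsIndecomposable.bijective_or {X : FDMod K A} (hX : X.IsIndecomposable)
    (f g : X →ₗ[A] X) (h : f + g = LinearMap.id) :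
    Function.Bijective f ∨ Function.Bijective g := by
  obtain ⟨k, hk1, hk⟩ := exists_isCompl_ker_pow_range_pow f
  have hfk : ∀ n, f ^ (n + 1) = (f ^ n).comp f := fun n => pow_succ f n
  rcases hX.2 _ _ (iso_of_isCompl hk) with hs | hs
  · left
    apply bijective_of_injective
    rw [← LinearMap.ker_eq_bot, eq_bot_iff]
    intro x hx
    have hx' : x ∈ LinearMap.ker (f ^ k) := by
      obtain ⟨j, rfl⟩ : ∃ j, k = j + 1 := ⟨k - 1, by omega⟩
      rw [LinearMap.mem_ker, hfk, LinearMap.comp_apply, LinearMap.mem_ker.1 hx, map_zero]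
    exact congrArg Subtype.val (hs.elim (⟨x, hx'⟩ : LinearMap.ker (f ^ k)) 0)
  · -- `f` is nilpotent, so `g = 1 - f` is invertible.
    right
    apply bijective_of_injective
    rw [← LinearMap.ker_eq_bot, eq_bot_iff]
    intro x hx
    have hfx : f x = x := by
      have := LinearMap.congr_fun h x
      simpa [LinearMap.mem_ker.1 hx] using this
    have hfkx : ∀ n, (f ^ n) x = x := by
      intro n
      induction n with
      | zero => rfl
      | succ n ih => rw [hfk, LinearMap.comp_apply, hfx, ih]
    have h0 : (⟨(f ^ k) x, ⟨x, rfl⟩⟩ : LinearMap.range (f ^ k)) = 0 := hs.elim _ _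
    have h1 : (f ^ k) x = 0 := congrArg Subtype.val h0
    rw [hfkx] at h1
    exact h1

section Retractions

variable {R X Z M N E : Type*} [Ring R] [AddCommGroup X] [AddCommGroup Z] [AddCommGroup M]
  [AddCommGroup N] [AddCommGroup E] [Module R X] [Module R Z] [Module R M] [Module R N]
  [Module R E]

/-- Two retractions of the same map `i` have isomorphic kernels, both being complements of the
range of `i`. -/
theorem ker_equiv_of_retractions (i : X →ₗ[R] E) (p q : E →ₗ[R] X)
    (hp : ∀ x, p (i x) = x) (hq : ∀ x, q (i x) = x) :
    Nonempty (LinearMap.ker p ≃ₗ[R] LinearMap.ker q) := by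
  refine ⟨LinearEquiv.ofLinearMap
    (LinearMap.codRestrict _ ((LinearMap.id - i.comp q).comp (LinearMap.ker p).subtype) ?_)
    (LinearMap.codRestrict _ ((LinearMap.id - i.comp p).comp (LinearMap.ker q).subtype) ?_) ?_ ?_⟩
  · intro x; simp [hq]
  · intro x; simp [hp]
  · refine LinearMap.ext fun x => Subtype.ext ?_
    have : q x.1 = 0 := x.2
    change x.1 - i (p x.1) - i (q (x.1 - i (p x.1))) = x.1
    simp [hq, this]
  · refine LinearMap.ext fun x => Subtype.ext ?_
    have : p x.1 = 0 := x.2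
    change x.1 - i (q x.1) - i (p (x.1 - i (q x.1))) = x.1
    simp [hp, this]

/-- A module is the sum of a retract and the kernel of the retraction. -/
theorem equiv_prod_ker_of_retraction (i : X →ₗ[R] E) (p : E →ₗ[R] X)
    (hp : ∀ x, p (i x) = x) : Nonempty (E ≃ₗ[R] (X × LinearMap.ker p)) := by
  refine ⟨LinearEquiv.ofLinearMap
    (p.prod (LinearMap.codRestrict _ (LinearMap.id - i.comp p) ?_))
    (i.coprod (LinearMap.ker p).subtype) ?_ ?_⟩
  · intro x; simp [hp]
  · apply LinearMap.ext
    rintro ⟨x, y⟩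
    have : p y.1 = 0 := y.2
    refine Prod.ext ?_ (Subtype.ext ?_) <;> simp [hp, this]
  · ext x
    simp

/-- If the component `X → M → X` of the identity of `X` through an isomorphism
`X ⊕ Z ≃ M ⊕ N` is bijective, then `X` splits off `M` and can be cancelled. -/
theorem exists_equiv_prod_of_bijective (φ : (X × Z) ≃ₗ[R] (M × N))
    (h : Function.Bijective fun x : X => (φ.symm ((φ (x, 0)).1, 0)).1) :
    ∃ M' : Submodule R M, Nonempty (M ≃ₗ[R] (X × M')) ∧ Nonempty (Z ≃ₗ[R] (M' × N)) := by
  let i₁ : X →ₗ[R] M := (LinearMap.fst R M N).comp (φ.toLinearMap.comp (LinearMap.inl R X Z))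
  let r : M →ₗ[R] X := ((LinearMap.fst R X Z).comp φ.symm.toLinearMap).comp (LinearMap.inl R M N)
  let u : X ≃ₗ[R] X := LinearEquiv.ofBijective (r.comp i₁) h
  let p₁ : M →ₗ[R] X := u.symm.toLinearMap.comp r
  have hp₁ : ∀ x, p₁ (i₁ x) = x := fun x => u.symm_apply_apply x
  refine ⟨LinearMap.ker p₁, equiv_prod_ker_of_retraction i₁ p₁ hp₁, ?_⟩
  let q : (X × Z) →ₗ[R] X := p₁.comp ((LinearMap.fst R M N).comp φ.toLinearMap)
  obtain ⟨e⟩ := ker_equiv_of_retractions (LinearMap.inl R X Z) (LinearMap.fst R X Z) q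
    (fun _ => rfl) hp₁
  let e₁ : Z ≃ₗ[R] LinearMap.ker (LinearMap.fst R X Z) :=
    LinearEquiv.ofLinearMap (LinearMap.codRestrict _ (LinearMap.inr R X Z) (fun _ => rfl))
      ((LinearMap.snd R X Z).comp (Submodule.subtype _)) (by
        ext x
        · exact x.2.symm
        · rfl) rfl
  let e₂ : LinearMap.ker q ≃ₗ[R] (LinearMap.ker p₁ × N) :=
    LinearEquiv.ofLinearMap
      ((LinearMap.codRestrict _ ((LinearMap.fst R M N).comp
        (φ.toLinearMap.comp (Submodule.subtype _))) (fun x => x.2)).prod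
        ((LinearMap.snd R M N).comp (φ.toLinearMap.comp (Submodule.subtype _))))
      (LinearMap.codRestrict _ (φ.symm.toLinearMap.comp
        ((Submodule.subtype _).prodMap LinearMap.id)) (by
          intro x
          simp only [q, LinearMap.mem_ker, LinearMap.comp_apply, LinearEquiv.coe_coe,
            LinearEquiv.apply_symm_apply, LinearMap.fst_apply, LinearMap.prodMap_apply]
          exact x.1.2))
      (by
        apply LinearMap.ext
        rintro ⟨x, y⟩
        refine Prod.ext (Subtype.ext ?_) ?_
        · change (φ (φ.symm (x.1, y))).1 = x.1
          simp
        · simp)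
      (by
        apply LinearMap.ext
        intro x
        apply Subtype.ext
        exact φ.symm_apply_apply x.1)
  exact ⟨e₁.trans (e.trans e₂)⟩

end Retractions

/-- The exchange property behind the Krull–Schmidt theorem: an indecomposable summand `X` of
`M ⊕ N` is a summand of `M` or of `N`, and it can be cancelled there. -/
theorem IsIndecomposable.exchange {X Z M N : FDMod K A} (hX : X.IsIndecomposable)
    (h : (X.sum Z).Iso (M.sum N)) :
    (∃ M' : FDMod K A, M.Iso (X.sum M') ∧ Z.Iso (M'.sum N)) ∨
      ∃ N' : FDMod K A, N.Iso (X.sum N') ∧ Z.Iso (M.sum N') := by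
  obtain ⟨φ⟩ : Nonempty ((X × Z) ≃ₗ[A] (M × N)) := h
  let ψ : (X × Z) ≃ₗ[A] (N × M) := φ.trans (LinearEquiv.prodComm A M N)
  let f : X →ₗ[A] X := ((LinearMap.fst A X Z).comp φ.symm.toLinearMap).comp
    ((LinearMap.inl A M N).comp ((LinearMap.fst A M N).comp
      (φ.toLinearMap.comp (LinearMap.inl A X Z))))
  let g : X →ₗ[A] X := ((LinearMap.fst A X Z).comp ψ.symm.toLinearMap).comp
    ((LinearMap.inl A N M).comp ((LinearMap.fst A N M).comp
      (ψ.toLinearMap.comp (LinearMap.inl A X Z))))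
  have hfg : f + g = LinearMap.id := by
    apply LinearMap.ext
    intro x
    change (φ.symm ((φ (x, 0)).1, 0)).1 + (φ.symm (0, (φ (x, 0)).2)).1 = x
    rw [← Prod.fst_add, ← map_add]
    simp
  rcases hX.bijective_or f g hfg with h | h
  · obtain ⟨M', h1, h2⟩ := exists_equiv_prod_of_bijective φ h
    exact Or.inl ⟨M.ofSubmodule M', h1, h2⟩
  · obtain ⟨N', h1, h2⟩ := exists_equiv_prod_of_bijective ψ h
    have h3 : Z.Iso ((N.ofSubmodule N').sum M) := h2
    exact Or.inr ⟨N.ofSubmodule N', h1, h3.trans (sumComm _ M)⟩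

/-! ### Splitting off projective summands -/

/-- `M` has no nonzero projective direct summand. -/
def NoProjSummand (M : FDMod K A) : Prop :=
  ∀ Q : FDMod K A, Module.Projective A Q → Q.IsSummand M → Subsingleton Q

theorem NoProjSummand.summand {M N : FDMod K A} (h : M.NoProjSummand) (hN : N.IsSummand M) :
    N.NoProjSummand := fun Q hQ hQN => h Q hQ (hQN.trans hN)

theorem IsIndecomposable.not_summand_both {X M N : FDMod K A} (hX : X.IsIndecomposable)
    (hM : M.NoProjSummand) (hN : Module.Projective A N) (h : X.IsSummand M) :
    ¬ X.IsSummand N := fun h' =>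
  not_subsingleton_iff_nontrivial.2 hX.1 (hM X (h'.projective hN) h)

/-- The maximal projective summand of a module is unique up to isomorphism. -/
theorem projective_part_iso {P P' N N' : FDMod K A} (hP : Module.Projective A P)
    (hP' : Module.Projective A P') (hN : N.NoProjSummand) (hN' : N'.NoProjSummand)
    (h : (P.sum N).Iso (P'.sum N')) : P.Iso P' := by
  induction hn : Module.finrank K P using Nat.strong_induction_on generalizing P P' with
  | _ n ih =>
    rcases subsingleton_or_nontrivial P with hs | hnt
    · exact iso_of_subsingleton hs (hN P' hP'
        (((isSummand_sum_left P' N').iso_right h.symm).iso_right (sum_iso_right P N hs)))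
    · obtain ⟨X, Y, hX, e⟩ := exists_indecomposable_summand P hnt
      have hXP : Module.Projective A X := IsSummand.projective ⟨Y, e⟩ hP
      have hYP : Module.Projective A Y :=
        ((isSummand_sum_right X Y).iso_right e.symm).projective hP
      have h' : (X.sum (Y.sum N)).Iso (P'.sum N') :=
        (sumAssoc X Y N).symm.trans ((e.symm.sum (isoRefl N)).trans h)
      rcases hX.exchange h' with ⟨M', h1, h2⟩ | ⟨M', h1, h2⟩
      · have hM'P : Module.Projective A M' :=
          ((isSummand_sum_right X M').iso_right h1.symm).projective hP'
        have h3 := e.finrank_eq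
        rw [finrank_sum] at h3
        have h4 : 0 < Module.finrank K X := have := hX.1; Module.finrank_pos
        exact e.trans (((isoRefl X).sum (ih _ (by omega) hYP hM'P h2 rfl)).trans h1.symm)
      · exact absurd (hN' X hXP ⟨M', h1⟩) (not_subsingleton_iff_nontrivial.2 hX.1)

/-- By exchange, an indecomposable summand of `M ⊕ N` is a summand of `M` or of `N`; it cannot be
both, as it would be a projective summand of `M`. -/
theorem numSummands_sum {M N : FDMod K A} (hM : M.NoProjSummand) (hN : Module.Projective A N) :
    (M.sum N).numSummands = M.numSummands + N.numSummands := by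
  unfold numSummands
  rw [← Set.encard_union_eq]
  · congr 1
    ext c
    constructor
    · rintro ⟨X, hX, ⟨Z, hZ⟩, rfl⟩
      rcases hX.exchange hZ.symm with ⟨M', h1, -⟩ | ⟨M', h1, -⟩
      · exact Or.inl ⟨X, hX, ⟨M', h1⟩, rfl⟩
      · exact Or.inr ⟨X, hX, ⟨M', h1⟩, rfl⟩
    · rintro (⟨X, hX, h, rfl⟩ | ⟨X, hX, h, rfl⟩)
      · exact ⟨X, hX, h.trans (isSummand_sum_left M N), rfl⟩
      · exact ⟨X, hX, h.trans (isSummand_sum_right M N), rfl⟩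
  · rw [Set.disjoint_left]
    rintro c ⟨X, hX, h, rfl⟩ ⟨Y, hY, h', hc⟩
    exact hX.not_summand_both hM hN h (h'.iso (Quotient.exact hc))

theorem IsBasic.sum {M N : FDMod K A} (hM : M.IsBasic) (hN : N.IsBasic)
    (hM' : M.NoProjSummand) (hN' : Module.Projective A N) : (M.sum N).IsBasic := by
  intro X Y Z hX hY h hXY
  -- Cancelling one copy of `X` from `X ⊕ X ⊕ Z ≅ M ⊕ N` places the other copy as well: both lie
  -- in `M`, both lie in `N`, or `X` is a projective summand of `M`.
  have h0 : (X.sum (X.sum Z)).Iso (M.sum N) :=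
    (sumAssoc X X Z).symm.trans ((((isoRefl X).sum hXY).sum (isoRefl Z)).trans h.symm)
  rcases hX.exchange h0 with ⟨M₁, h1, h2⟩ | ⟨N₁, h1, h2⟩
  · rcases hX.exchange h2 with ⟨M₂, h3, -⟩ | ⟨N₂, h3, -⟩
    · exact hM X X M₂ hX hX (h1.trans (((isoRefl X).sum h3).trans (sumAssoc X X M₂).symm))
        (isoRefl X)
    · exact hX.not_summand_both hM' hN' ⟨M₁, h1⟩ ⟨N₂, h3⟩
  · rcases hX.exchange h2 with ⟨M₂, h3, -⟩ | ⟨N₂, h3, -⟩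
    · exact hX.not_summand_both hM' hN' ⟨M₂, h3⟩ ⟨N₁, h1⟩
    · exact hN X X N₂ hX hX (h1.trans (((isoRefl X).sum h3).trans (sumAssoc X X N₂).symm))
        (isoRefl X)

end FDMod

/-! ### Correspondences that preserve direct sums -/

variable {B : Type u} [Ring B] [Algebra K B]

/-- Two operations `F` and `G` on isomorphism classes of modules that commute with finite direct
sums and are mutually inverse on the classes `𝒞` and `𝒟`, which are closed under summands. No
functoriality is required, so the transpose fits as well as the dualities. -/
structure SummandCorrespondence (𝒞 : FDMod K A → Prop) (𝒟 : FDMod K B → Prop)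
    (F : FDMod K A → FDMod K B) (G : FDMod K B → FDMod K A) : Prop where
  closed_left : ∀ {X M}, 𝒞 M → X.IsSummand M → 𝒞 X
  closed_right : ∀ {X M}, 𝒟 M → X.IsSummand M → 𝒟 X
  map_left : ∀ {M}, 𝒞 M → 𝒟 (F M)
  map_right : ∀ {M}, 𝒟 M → 𝒞 (G M)
  iso_left : ∀ {M N}, M.Iso N → (F M).Iso (F N)
  iso_right : ∀ {M N}, M.Iso N → (G M).Iso (G N)
  sum_left : ∀ M N, (F (M.sum N)).Iso ((F M).sum (F N))
  sum_right : ∀ M N, (G (M.sum N)).Iso ((G M).sum (G N))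
  left_inv : ∀ {M}, 𝒞 M → (G (F M)).Iso M
  right_inv : ∀ {M}, 𝒟 M → (F (G M)).Iso M

namespace SummandCorrespondence

open FDMod

variable {𝒞 : FDMod K A → Prop} {𝒟 : FDMod K B → Prop}
  {F : FDMod K A → FDMod K B} {G : FDMod K B → FDMod K A}

theorem symm (h : SummandCorrespondence 𝒞 𝒟 F G) : SummandCorrespondence 𝒟 𝒞 G F :=
  ⟨h.closed_right, h.closed_left, h.map_right, h.map_left, h.iso_right, h.iso_left, h.sum_right,
    h.sum_left, h.right_inv, h.left_inv⟩

/-- Additivity alone forces `F 0 = 0`, by comparing dimensions in `F 0 ≅ F 0 ⊕ F 0`. -/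
theorem subsingleton (h : SummandCorrespondence 𝒞 𝒟 F G) {M : FDMod K A} (hM : Subsingleton M) :
    Subsingleton (F M) :=
  subsingleton_of_iso_sum_self ((h.iso_left (iso_sum_self hM)).trans (h.sum_left M M))

theorem isSummand (h : SummandCorrespondence 𝒞 𝒟 F G) {X M : FDMod K A} (hX : X.IsSummand M) :
    (F X).IsSummand (F M) :=
  let ⟨Z, hZ⟩ := hX; ⟨F Z, (h.iso_left hZ).trans (h.sum_left X Z)⟩

theorem isIndecomposable (h : SummandCorrespondence 𝒞 𝒟 F G) {X : FDMod K A} (hC : 𝒞 X)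
    (hX : X.IsIndecomposable) : (F X).IsIndecomposable := by
  constructor
  · by_contra hn
    have hs : Subsingleton (F X) := not_nontrivial_iff_subsingleton.1 hn
    exact not_subsingleton_iff_nontrivial.2 hX.1
      ((h.left_inv hC).subsingleton (h.symm.subsingleton hs))
  · intro Y Z e
    have hD := h.map_left hC
    have hY := h.closed_right hD ⟨Z, e⟩
    have hZ := h.closed_right hD ((isSummand_sum_right Y Z).iso_right e.symm)
    exact (hX.2 _ _ ((h.left_inv hC).symm.trans ((h.iso_right e).trans (h.sum_right Y Z)))).imp
      (fun hs => (h.right_inv hY).subsingleton (h.subsingleton hs))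
      (fun hs => (h.right_inv hZ).subsingleton (h.subsingleton hs))

theorem isBasic (h : SummandCorrespondence 𝒞 𝒟 F G) {M : FDMod K A} (hC : 𝒞 M)
    (hM : M.IsBasic) : (F M).IsBasic := by
  intro X Y Z hX hY e hXY
  have hD := h.map_left hC
  have hXY' : (X.sum Y).IsSummand (F M) := ⟨Z, e⟩
  exact hM (G X) (G Y) (G Z)
    (h.symm.isIndecomposable (h.closed_right hD ((isSummand_sum_left X Y).trans hXY')) hX)
    (h.symm.isIndecomposable (h.closed_right hD ((isSummand_sum_right X Y).trans hXY')) hY)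
    ((h.left_inv hC).symm.trans ((h.iso_right e).trans ((h.sum_right _ Z).trans
      ((h.sum_right X Y).sum (isoRefl _))))) (h.iso_right hXY)

/-- `F` induces an injection from the indecomposable summands of `M` to those of `F M`. -/
theorem numSummands_le (h : SummandCorrespondence 𝒞 𝒟 F G) {M : FDMod K A} (hC : 𝒞 M) :
    M.numSummands ≤ (F M).numSummands := by
  refine Set.encard_le_encard_of_injOn
    (f := Quotient.map F fun _ _ e => h.iso_left e) ?_ ?_
  · rintro c ⟨X, hX, hXM, rfl⟩
    exact ⟨F X, h.isIndecomposable (h.closed_left hC hXM) hX, h.isSummand hXM, rfl⟩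
  · rintro c ⟨X, hX, hXM, rfl⟩ c' ⟨Y, hY, hYM, rfl⟩ hc
    have e : (F X).Iso (F Y) := Quotient.exact hc
    exact Quotient.sound ((h.left_inv (h.closed_left hC hXM)).symm.trans
      ((h.iso_right e).trans (h.left_inv (h.closed_left hC hYM))))

theorem numSummands_eq (h : SummandCorrespondence 𝒞 𝒟 F G) {M : FDMod K A} (hC : 𝒞 M) :
    (F M).numSummands = M.numSummands :=
  le_antisymm ((h.symm.numSummands_le (h.map_left hC)).trans_eq
    (numSummands_congr (h.left_inv hC))) (h.numSummands_le hC)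

end SummandCorrespondence

namespace FDMod

/-! ### Dual bases and the functor `Hom(-, A)` on projective modules -/

/-- A finitely generated projective module has a finite dual basis. -/
theorem exists_dualBasis (P : FDMod K A) (_ : Module.Projective A P) :
    ∃ (n : ℕ) (p : Fin n → P) (f : Fin n → (P →ₗ[A] A)), ∀ x, ∑ i, f i x • p i = x := by
  have : Module.Finite A P := Module.Finite.of_restrictScalars_finite K A P
  obtain ⟨n, g, hg⟩ := Module.Finite.exists_fin' A P
  obtain ⟨s, hs⟩ := g.exists_rightInverse_of_surjective (LinearMap.range_eq_top.2 hg)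
  refine ⟨n, fun i => g (fun j => if i = j then 1 else 0), fun i => (LinearMap.proj i).comp s,
    fun x => ?_⟩
  have h1 : g (s x) = x := LinearMap.congr_fun hs x
  rw [LinearMap.pi_apply_eq_sum_univ] at h1
  exact h1

theorem _root_.Module.Projective.of_dualBasis {R M : Type*} [Ring R] [AddCommGroup M] [Module R M]
    {n : ℕ} (p : Fin n → M) (f : Fin n → (M →ₗ[R] R)) (h : ∀ x, ∑ i, f i x • p i = x) :
    Module.Projective R M := by
  refine Module.Projective.of_split (LinearMap.pi f)
    (∑ i, (LinearMap.toSpanSingleton R M (p i)).comp (LinearMap.proj i)) ?_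
  ext x
  simpa using h x

/-- A dual basis `(pᵢ, fᵢ)` of `P` yields a dual basis of `P*`: every `f` is `∑ᵢ fᵢ · f(pᵢ)`. -/
theorem star_dualBasis {P : FDMod K A} {n : ℕ} {p : Fin n → P} {f : Fin n → (P →ₗ[A] A)}
    (h : ∀ x, ∑ i, f i x • p i = x) (g : P →ₗ[A] A) : ∑ i, op (g (p i)) • f i = g := by
  ext x
  conv_rhs => rw [← h x]
  simp [LinearMap.sum_apply]

/-- Over a projective module, lifts along `g` exist as soon as the ranges allow them. -/
theorem exists_lift_of_range_le {P Q X : FDMod K A} (_ : Module.Projective A P) (f : P →ₗ[A] X)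
    (g : Q →ₗ[A] X) (h : LinearMap.range f ≤ LinearMap.range g) :
    ∃ l : P →ₗ[A] Q, g.comp l = f := by
  obtain ⟨l, hl⟩ := Module.projective_lifting_property g.rangeRestrict
    (f.codRestrict (LinearMap.range g) fun x => h ⟨x, rfl⟩) g.surjective_rangeRestrict
  refine ⟨l, LinearMap.ext fun x => ?_⟩
  exact congrArg Subtype.val (LinearMap.congr_fun hl x)

section Star

variable [Module.Finite K A]

theorem starMap_bijective {M N : FDMod K A} {f : M →ₗ[A] N} (hf : Function.Bijective f) :
    Function.Bijective (starMap f) := by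
  let e := LinearEquiv.ofBijective f hf
  refine Function.bijective_iff_has_inverse.2 ⟨starMap e.symm.toLinearMap, fun g => ?_, fun g => ?_⟩
  · exact LinearMap.ext fun x => congrArg (DFunLike.coe (F := N →ₗ[A] A) g) (e.apply_symm_apply x)
  · exact LinearMap.ext fun x => congrArg (DFunLike.coe (F := M →ₗ[A] A) g) (e.symm_apply_apply x)

theorem Iso.star {M N : FDMod K A} : M.Iso N → M.star.Iso N.star :=
  fun ⟨e⟩ => ⟨LinearEquiv.symm (LinearEquiv.ofBijective (starMap e.toLinearMap)
    (starMap_bijective e.bijective))⟩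

theorem star_sum (M N : FDMod K A) : (M.sum N).star.Iso (M.star.sum N.star) :=
  ⟨(LinearMap.coprodEquiv (R := A) (M := M) (M₂ := N) (M₃ := A) Aᵐᵒᵖ).symm⟩

theorem projective_star {P : FDMod K A} (hP : Module.Projective A P) :
    Module.Projective Aᵐᵒᵖ P.star := by
  obtain ⟨n, p, f, h⟩ := exists_dualBasis P hP
  exact Module.Projective.of_dualBasis (M := P →ₗ[A] A) f
    (fun i => { toFun := fun g => op (g (p i)), map_add' := fun _ _ => rfl,
                map_smul' := fun _ _ => rfl })
    (star_dualBasis h)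

/-- `(-)*` is full on maps into a projective module. -/
theorem starMap_surjective {M P : FDMod K A} (hP : Module.Projective A P)
    (g : P.star →ₗ[Aᵐᵒᵖ] M.star) : ∃ g' : M →ₗ[A] P, starMap g' = g := by
  obtain ⟨n, p, f, h⟩ := exists_dualBasis P hP
  let g₀ : (P →ₗ[A] A) →ₗ[Aᵐᵒᵖ] (M →ₗ[A] A) := g
  refine ⟨∑ i, (LinearMap.toSpanSingleton A P (p i)).comp (g₀ (f i)), ?_⟩
  refine LinearMap.ext fun (k : P →ₗ[A] A) => LinearMap.ext fun (x : M) => ?_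
  change k ((∑ i, (LinearMap.toSpanSingleton A P (p i)).comp (g₀ (f i))) x) = g₀ k x
  conv_rhs => rw [← star_dualBasis h k]
  simp [LinearMap.sum_apply]

/-- `(-)*` is faithful on maps into a projective module. -/
theorem starMap_injective {M P : FDMod K A} (hP : Module.Projective A P) {f g : M →ₗ[A] P}
    (h : starMap f = starMap g) : f = g := by
  obtain ⟨n, p, k, hk⟩ := exists_dualBasis P hP
  ext x
  rw [← hk (f x), ← hk (g x)]
  refine Finset.sum_congr rfl fun i _ => ?_
  have : (k i).comp f = (k i).comp g := LinearMap.congr_fun h (k i)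
  rw [show k i (f x) = k i (g x) from LinearMap.congr_fun this x]

/-- The evaluation map `M → M**`. -/
def evalStar (M : FDMod K A) : M →ₗ[A] M.star.star.ofOpOp where
  toFun x := ({ toFun := fun g => op (g x), map_add' := fun _ _ => rfl,
                map_smul' := fun _ _ => rfl } : (M →ₗ[A] A) →ₗ[Aᵐᵒᵖ] Aᵐᵒᵖ)
  map_add' x y := LinearMap.ext fun g : M →ₗ[A] A => congrArg op (g.map_add x y)
  map_smul' a x := LinearMap.ext fun g : M →ₗ[A] A => congrArg op (g.map_smul a x)

theorem evalStar_bijective {P : FDMod K A} (hP : Module.Projective A P) :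
    Function.Bijective (evalStar P) := by
  obtain ⟨n, p, f, h⟩ := exists_dualBasis P hP
  have hev : ∀ (x : P) (g : P →ₗ[A] A),
    DFunLike.coe (F := (P →ₗ[A] A) →ₗ[Aᵐᵒᵖ] Aᵐᵒᵖ) (evalStar P x) g = op (g x) := fun _ _ => rfl
  constructor
  · intro x y hxy
    rw [← h x, ← h y]
    refine Finset.sum_congr rfl fun i _ => ?_
    have := op_injective (LinearMap.congr_fun
      (show (evalStar P x : (P →ₗ[A] A) →ₗ[Aᵐᵒᵖ] Aᵐᵒᵖ) = evalStar P y from hxy) (f i))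
    rw [show f i x = f i y from this]
  · intro φ
    let φ₀ : (P →ₗ[A] A) →ₗ[Aᵐᵒᵖ] Aᵐᵒᵖ := φ
    refine ⟨∑ i, unop (φ₀ (f i)) • p i, ?_⟩
    refine LinearMap.ext fun k : P →ₗ[A] A => ?_
    change op (k (∑ i, unop (φ₀ (f i)) • p i)) = φ₀ k
    conv_rhs => rw [← star_dualBasis h k]
    simp

theorem star_star_iso {P : FDMod K A} (hP : Module.Projective A P) :
    P.star.star.ofOpOp.Iso P :=
  ⟨(LinearEquiv.ofBijective _ (evalStar_bijective hP)).symm⟩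

end Star

/-! ### Minimality of maps between projective modules -/

/-- A map `d : P → Q` is radical if `1 - d g` is invertible for all `g : Q → P`. -/
def IsRadical {P Q : FDMod K A} (d : P →ₗ[A] Q) : Prop :=
  ∀ g : Q →ₗ[A] P, Function.Bijective (LinearMap.id - d.comp g : Q →ₗ[A] Q)

/-- A map `d : P → Q` is right minimal if `d h = d` forces `h` to be invertible. -/
def IsRightMinimal {P Q : FDMod K A} (d : P →ₗ[A] Q) : Prop :=
  ∀ h : P →ₗ[A] P, d.comp h = d → Function.Bijective h

/-- A map `d : P → Q` is left minimal if `h d = d` forces `h` to be invertible. -/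
def IsLeftMinimal {P Q : FDMod K A} (d : P →ₗ[A] Q) : Prop :=
  ∀ h : Q →ₗ[A] Q, h.comp d = d → Function.Bijective h

/-- For projective `Q`, a map `d : P → Q` is radical exactly when its range is superfluous. -/
theorem isRadical_iff {P Q : FDMod K A} (hQ : Module.Projective A Q) (d : P →ₗ[A] Q) :
    IsRadical d ↔ ∀ N : Submodule A Q, N ⊔ LinearMap.range d = ⊤ → N = ⊤ := by
  constructor
  · intro h N hN
    -- The projection `Q → Q / N` factors through `d` as `mk ∘ d ∘ g`, so `1 - d g` maps into `N`.
    have hs : Function.Surjective (N.mkQ.comp d) := by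
      rw [← LinearMap.range_eq_top, LinearMap.range_comp, Submodule.map_mkQ_eq_top]
      exact hN
    obtain ⟨g, hg⟩ := Module.projective_lifting_property (N.mkQ.comp d) N.mkQ hs
    rw [eq_top_iff]
    intro x _
    obtain ⟨y, rfl⟩ := (h g).2 x
    have : N.mkQ (d (g y)) = N.mkQ y := LinearMap.congr_fun hg y
    exact (Submodule.Quotient.eq N).1 this.symm
  · intro h g
    apply bijective_of_surjective
    rw [← LinearMap.range_eq_top]
    apply h
    rw [eq_top_iff]
    intro x _
    exact Submodule.mem_sup.2 ⟨_, ⟨x, rfl⟩, d (g x), ⟨g x, rfl⟩, by simp⟩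

/-- For projective `P`, a map `d : P → X` is right minimal exactly when its kernel is
superfluous. -/
theorem isRightMinimal_iff {P X : FDMod K A} (hP : Module.Projective A P) (d : P →ₗ[A] X) :
    IsRightMinimal d ↔ ∀ N : Submodule A P, N ⊔ LinearMap.ker d = ⊤ → N = ⊤ := by
  constructor
  · intro h N hN
    obtain ⟨l, hl⟩ := exists_lift_of_range_le (Q := P.ofSubmodule N) hP d (d.comp N.subtype) (by
      rintro _ ⟨x, rfl⟩
      obtain ⟨y, hy, z, hz, rfl⟩ := Submodule.mem_sup.1 (hN ▸ Submodule.mem_top : x ∈ N ⊔ _)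
      refine ⟨⟨y, hy⟩, ?_⟩
      rw [map_add, LinearMap.mem_ker.1 hz, add_zero]
      rfl)
    rw [eq_top_iff]
    intro x _
    obtain ⟨y, rfl⟩ := (h (N.subtype.comp l) hl).2 x
    exact (l y).2
  · intro h f hf
    apply bijective_of_surjective
    rw [← LinearMap.range_eq_top]
    apply h
    rw [eq_top_iff]
    intro x _
    refine Submodule.mem_sup.2 ⟨f x, ⟨x, rfl⟩, x - f x, ?_, by simp⟩
    rw [LinearMap.mem_ker, map_sub, ← LinearMap.comp_apply, hf, sub_self]

/-- A map into a projective module is left minimal exactly when its cokernel has no nonzero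
projective summand: by Fitting's lemma, an `h` with `h d = d` that is not invertible splits a
projective module off the cokernel. -/
theorem isLeftMinimal_iff {P Q : FDMod K A} (hQ : Module.Projective A Q) (d : P →ₗ[A] Q) :
    IsLeftMinimal d ↔ (Q.quotient (LinearMap.range d)).NoProjSummand := by
  constructor
  · rintro hd R hR ⟨Z, hZ⟩
    obtain ⟨e⟩ : Nonempty ((Q ⧸ LinearMap.range d) ≃ₗ[A] (R × Z)) := hZ
    let p : Q →ₗ[A] R := ((LinearMap.fst A R Z).comp e.toLinearMap).comp (LinearMap.range d).mkQ
    have hp : Function.Surjective p := by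
      intro r
      obtain ⟨y, hy⟩ := (LinearMap.range d).mkQ_surjective (e.symm (r, 0))
      refine ⟨y, ?_⟩
      change (e ((LinearMap.range d).mkQ y)).1 = r
      rw [hy, e.apply_symm_apply]
    have hpd : ∀ x, p (d x) = 0 := by
      intro x
      have : (LinearMap.range d).mkQ (d x) = 0 := (Submodule.Quotient.mk_eq_zero _).2 ⟨x, rfl⟩
      change (e ((LinearMap.range d).mkQ (d x))).1 = 0
      rw [this, map_zero]; rfl
    obtain ⟨s, hs⟩ := p.exists_rightInverse_of_surjective (LinearMap.range_eq_top.2 hp)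
    have hs' : ∀ r, p (s r) = r := LinearMap.congr_fun hs
    have hb := hd (LinearMap.id - s.comp p) (by ext x; simp [hpd])
    refine ⟨fun r r' => ?_⟩
    have hz : ∀ r : R, r = 0 := fun r => by
      have : s r = 0 := hb.1 (by simp [hs'])
      rw [← hs' r, this, map_zero]
    rw [hz r, hz r']
  · intro h f hf
    obtain ⟨k, hk1, hk⟩ := exists_isCompl_ker_pow_range_pow f
    have hfk : ∀ n x, (f ^ n) (d x) = d x := by
      intro n x
      induction n with
      | zero => rfl
      | succ n ih => rw [pow_succ, Module.End.mul_apply, show f (d x) = d x from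
          LinearMap.congr_fun hf x, ih]
    let S := Q.ofSubmodule (LinearMap.ker (f ^ k))
    have hS : Module.Projective A S := IsSummand.projective ⟨_, iso_of_isCompl hk⟩ hQ
    let π : Q →ₗ[A] S := Submodule.projectionOnto _ _ hk
    have hπd : LinearMap.range d ≤ LinearMap.ker π := by
      rintro _ ⟨x, rfl⟩
      exact (Submodule.projectionOnto_apply_eq_zero_iff hk).2 ⟨d x, hfk k x⟩
    let r : (Q.quotient (LinearMap.range d)) →ₗ[A] S := (LinearMap.range d).liftQ π hπd
    let i : S →ₗ[A] (Q.quotient (LinearMap.range d)) :=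
      (LinearMap.range d).mkQ.comp (LinearMap.ker (f ^ k)).subtype
    have hri : ∀ x, r (i x) = x := fun x => Submodule.projectionOnto_apply_left hk x
    have hs : Subsingleton S :=
      h S hS ⟨(Q.quotient _).ofSubmodule (LinearMap.ker r), equiv_prod_ker_of_retraction i r hri⟩
    apply bijective_of_injective
    rw [← LinearMap.ker_eq_bot, eq_bot_iff]
    intro x hx
    have hx' : x ∈ LinearMap.ker (f ^ k) := by
      obtain ⟨j, rfl⟩ : ∃ j, k = j + 1 := ⟨k - 1, by omega⟩
      rw [LinearMap.mem_ker, pow_succ, Module.End.mul_apply, LinearMap.mem_ker.1 hx, map_zero]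
    exact congrArg Subtype.val (hs.elim (⟨x, hx'⟩ : LinearMap.ker (f ^ k)) 0)

/-- The roles of `1 - d g` and `1 - g d` in the definition of a radical map are
interchangeable. -/
theorem IsRadical.bijective_id_sub_comp {P Q : FDMod K A} {d : P →ₗ[A] Q} (hd : IsRadical d)
    (g : Q →ₗ[A] P) : Function.Bijective (LinearMap.id - g.comp d : P →ₗ[A] P) := by
  apply bijective_of_injective
  rw [← LinearMap.ker_eq_bot, eq_bot_iff]
  intro x hx
  have hx' : x = g (d x) := sub_eq_zero.1 hx
  have h0 : d x = 0 := (hd g).1 (by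
    rw [map_zero, LinearMap.sub_apply, LinearMap.comp_apply, ← hx']
    exact sub_self _)
  rw [Submodule.mem_bot, hx', h0, map_zero]

/-- Right minimal maps from projective modules with the same range are isomorphic. -/
theorem IsRightMinimal.exists_equiv {P Q X : FDMod K A} (hP : Module.Projective A P)
    (hQ : Module.Projective A Q) {f : P →ₗ[A] X} {g : Q →ₗ[A] X} (hf : IsRightMinimal f)
    (hg : IsRightMinimal g) (h : LinearMap.range f = LinearMap.range g) :
    ∃ e : P ≃ₗ[A] Q, g.comp e.toLinearMap = f := by
  obtain ⟨a, ha⟩ := exists_lift_of_range_le hP f g h.le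
  obtain ⟨b, hb⟩ := exists_lift_of_range_le hQ g f h.ge
  have h1 := hf (b.comp a) (by rw [← LinearMap.comp_assoc, hb, ha])
  have h2 := hg (a.comp b) (by rw [← LinearMap.comp_assoc, ha, hb])
  exact ⟨LinearEquiv.ofBijective a ⟨Function.Injective.of_comp (f := b) h1.1,
    Function.Surjective.of_comp (g := b) h2.2⟩, ha⟩

section Star

variable [Module.Finite K A]

theorem IsRadical.star {P Q : FDMod K A} (hP : Module.Projective A P) {d : P →ₗ[A] Q}
    (hd : IsRadical d) : IsRadical (starMap d) := by
  intro g
  obtain ⟨g', rfl⟩ := starMap_surjective (P := P) (M := Q) hP g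
  have : LinearMap.id - (starMap d).comp (starMap g') =
      starMap (LinearMap.id - g'.comp d) := by
    refine LinearMap.ext fun k : P →ₗ[A] A => LinearMap.ext fun x => ?_
    exact (map_sub k x (g' (d x))).symm
  rw [this]
  exact starMap_bijective (hd.bijective_id_sub_comp g')

theorem IsRightMinimal.star {P Q : FDMod K A} (hP : Module.Projective A P)
    (hQ : Module.Projective A Q) {d : P →ₗ[A] Q} (hd : IsRightMinimal d) :
    IsLeftMinimal (starMap d) := by
  intro h hh
  obtain ⟨h', rfl⟩ := starMap_surjective hP h
  exact starMap_bijective (hd h' (starMap_injective hQ hh))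

theorem IsLeftMinimal.star {P Q : FDMod K A} (hQ : Module.Projective A Q) {d : P →ₗ[A] Q}
    (hd : IsLeftMinimal d) : IsRightMinimal (starMap d) := by
  intro h hh
  obtain ⟨h', rfl⟩ := starMap_surjective hQ h
  exact starMap_bijective (hd h' (starMap_injective hQ hh))

end Star

/-! ### Superfluous submodules and cokernels -/

section Linear

variable {R M N M' N' M₁ M₂ N₁ N₂ : Type*} [Ring R] [AddCommGroup M] [AddCommGroup N]
  [AddCommGroup M'] [AddCommGroup N'] [AddCommGroup M₁] [AddCommGroup M₂] [AddCommGroup N₁]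
  [AddCommGroup N₂] [Module R M] [Module R N] [Module R M'] [Module R N'] [Module R M₁]
  [Module R M₂] [Module R N₁] [Module R N₂]

theorem superfluous_map {S : Submodule R M} (hS : ∀ L : Submodule R M, L ⊔ S = ⊤ → L = ⊤)
    (i : M →ₗ[R] N) (L : Submodule R N) (hL : L ⊔ S.map i = ⊤) : L = ⊤ := by
  have h1 : L.comap i = ⊤ := by
    apply hS
    rw [eq_top_iff]
    intro x _
    obtain ⟨l, hl, _, ⟨s, hs, rfl⟩, h⟩ := Submodule.mem_sup.1 (hL ▸ Submodule.mem_top :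
      i x ∈ L ⊔ S.map i)
    refine Submodule.mem_sup.2 ⟨x - s, ?_, s, hs, by simp⟩
    rwa [Submodule.mem_comap, map_sub, ← h, add_sub_cancel_right]
  rwa [sup_eq_left.2 (Submodule.map_le_iff_le_comap.2 (h1 ▸ le_top))] at hL

/-- Superfluous submodules are preserved by finite direct sums. -/
theorem superfluous_prod {S : Submodule R M} {T : Submodule R N}
    (hS : ∀ L : Submodule R M, L ⊔ S = ⊤ → L = ⊤) (hT : ∀ L : Submodule R N, L ⊔ T = ⊤ → L = ⊤)
    (L : Submodule R (M × N)) (hL : L ⊔ S.prod T = ⊤) : L = ⊤ := by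
  refine superfluous_map hS (LinearMap.inl R M N) L
    (superfluous_map hT (LinearMap.inr R M N) _ ?_)
  refine top_le_iff.1 (hL.symm.le.trans (sup_le (le_sup_left.trans le_sup_left) ?_))
  rintro ⟨x, y⟩ ⟨hx, hy⟩
  exact Submodule.mem_sup.2 ⟨(x, 0), (le_sup_right : _ ≤ L ⊔ S.map (LinearMap.inl R M N))
    ⟨x, hx, rfl⟩, (0, y), ⟨y, hy, rfl⟩, by simp⟩

/-- Isomorphic maps have isomorphic cokernels. -/
theorem coker_equiv (d : M →ₗ[R] N) (d' : M' →ₗ[R] N') (e : M ≃ₗ[R] M') (f : N ≃ₗ[R] N')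
    (h : ∀ x, f (d x) = d' (e x)) :
    Nonempty ((N ⧸ LinearMap.range d) ≃ₗ[R] (N' ⧸ LinearMap.range d')) := by
  refine ⟨Submodule.Quotient.equiv _ _ f ?_⟩
  ext y
  constructor
  · rintro ⟨_, ⟨x, rfl⟩, rfl⟩
    exact ⟨e x, (h x).symm⟩
  · rintro ⟨x, rfl⟩
    exact ⟨_, ⟨e.symm x, rfl⟩, by simp [h]⟩

theorem coker_prodMap_equiv (d : M →ₗ[R] N) (d' : M' →ₗ[R] N') :
    Nonempty (((N × N') ⧸ LinearMap.range (d.prodMap d')) ≃ₗ[R]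
      ((N ⧸ LinearMap.range d) × (N' ⧸ LinearMap.range d'))) := by
  let f := (LinearMap.range d).mkQ.prodMap (LinearMap.range d').mkQ
  have hf : Function.Surjective f :=
    (Submodule.mkQ_surjective _).prodMap (Submodule.mkQ_surjective _)
  refine ⟨(Submodule.quotEquivOfEq _ _ ?_).trans (f.quotKerEquivOfSurjective hf)⟩
  rw [LinearMap.ker_prodMap, LinearMap.range_prodMap, Submodule.ker_mkQ, Submodule.ker_mkQ]

end Linear

/-! ### Maps of modules over `(Aᵒᵖ)ᵒᵖ` -/

section OfOpOp

/-- A map of `(Aᵒᵖ)ᵒᵖ`-modules, regarded as a map of `A`-modules. -/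
def ofOpOpMap {M N : FDMod K Aᵐᵒᵖᵐᵒᵖ} (f : M →ₗ[Aᵐᵒᵖᵐᵒᵖ] N) : M.ofOpOp →ₗ[A] N.ofOpOp where
  toFun := f
  map_add' := f.map_add
  map_smul' a x := f.map_smul (op (op a)) x

theorem Iso.ofOpOp {M N : FDMod K Aᵐᵒᵖᵐᵒᵖ} : M.Iso N → M.ofOpOp.Iso N.ofOpOp := fun ⟨e⟩ =>
  ⟨LinearEquiv.ofBijective (ofOpOpMap e.toLinearMap) e.bijective⟩

theorem ofOpOp_coker {M N : FDMod K Aᵐᵒᵖᵐᵒᵖ} (d : M →ₗ[Aᵐᵒᵖᵐᵒᵖ] N) :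
    (N.quotient (LinearMap.range d)).ofOpOp.Iso
      (N.ofOpOp.quotient (LinearMap.range (ofOpOpMap d))) := by
  let f : N.ofOpOp →ₗ[A] (N.quotient (LinearMap.range d)).ofOpOp :=
    ofOpOpMap (N := N.quotient (LinearMap.range d)) (LinearMap.range d).mkQ
  have hf : Function.Surjective f := Submodule.mkQ_surjective (LinearMap.range d)
  have hk : LinearMap.range (ofOpOpMap d) = LinearMap.ker f := by
    ext x
    exact (Submodule.Quotient.mk_eq_zero (M := N) (LinearMap.range d)).symm
  exact Iso.symm ⟨(Submodule.quotEquivOfEq _ _ hk).trans (f.quotKerEquivOfSurjective hf)⟩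

end OfOpOp

/-! ### The transpose -/

theorem Iso.noProjSummand {M N : FDMod K A} (e : M.Iso N) (h : M.NoProjSummand) :
    N.NoProjSummand := fun Q hQ hN => h Q hQ (hN.iso_right e.symm)

namespace MinProjPres

variable {M N : FDMod K A}

theorem ker_eq_range (p : MinProjPres M) : LinearMap.ker p.π = LinearMap.range p.d :=
  LinearMap.exact_iff.1 p.exact

theorem isRightMinimal_π (p : MinProjPres M) : IsRightMinimal p.π :=
  (isRightMinimal_iff p.projective₀ p.π).2 p.minimal₀

theorem isRightMinimal_d (p : MinProjPres M) : IsRightMinimal p.d :=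
  (isRightMinimal_iff p.projective₁ p.d).2 p.minimal₁

theorem isRadical_d (p : MinProjPres M) : IsRadical p.d :=
  (isRadical_iff p.projective₀ p.d).2 fun L hL => p.minimal₀ L (p.ker_eq_range ▸ hL)

theorem iso_coker (p : MinProjPres M) : (p.P₀.quotient (LinearMap.range p.d)).Iso M :=
  ⟨(Submodule.quotEquivOfEq _ _ p.ker_eq_range.symm).trans
    (p.π.quotKerEquivOfSurjective p.surjective)⟩

/-- A presentation of `M` is a presentation of every isomorphic module. -/
def congr (p : MinProjPres M) (e : M ≃ₗ[A] N) : MinProjPres N where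
  P₁ := p.P₁
  P₀ := p.P₀
  projective₁ := p.projective₁
  projective₀ := p.projective₀
  d := p.d
  π := e.toLinearMap.comp p.π
  surjective := e.surjective.comp p.surjective
  exact := fun x => by
    rw [LinearMap.comp_apply, LinearEquiv.coe_coe, e.map_eq_zero_iff]
    exact p.exact x
  minimal₀ := fun L hL => p.minimal₀ L (by rwa [LinearEquiv.ker_comp] at hL)
  minimal₁ := p.minimal₁

/-- The direct sum of two minimal projective presentations. -/
def sum (p : MinProjPres M) (q : MinProjPres N) : MinProjPres (M.sum N) where
  P₁ := p.P₁.sum q.P₁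
  P₀ := p.P₀.sum q.P₀
  projective₁ := projective_sum p.projective₁ q.projective₁
  projective₀ := projective_sum p.projective₀ q.projective₀
  d := p.d.prodMap q.d
  π := p.π.prodMap q.π
  surjective := p.surjective.prodMap q.surjective
  exact := fun ⟨x, y⟩ => by
    refine Prod.mk_eq_zero.trans ((and_congr (p.exact x) (q.exact y)).trans ?_)
    exact ⟨fun ⟨⟨a, ha⟩, ⟨b, hb⟩⟩ => ⟨(a, b), Prod.ext ha hb⟩,
      fun ⟨z, hz⟩ => ⟨⟨z.1, congrArg Prod.fst hz⟩, ⟨z.2, congrArg Prod.snd hz⟩⟩⟩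
  minimal₀ := fun L hL => superfluous_prod p.minimal₀ q.minimal₀ L
    ((congrArg _ (LinearMap.ker_prodMap p.π q.π)).symm.trans hL)
  minimal₁ := fun L hL => superfluous_prod p.minimal₁ q.minimal₁ L
    ((congrArg _ (LinearMap.ker_prodMap p.d q.d)).symm.trans hL)

/-- The presentation `0 → P → P → 0` of a projective module. -/
def ofProjective (hM : Module.Projective A M) : MinProjPres M where
  P₁ := zero K A
  P₀ := M
  projective₁ := inferInstanceAs (Module.Projective A PUnit.{u + 1})
  projective₀ := hM
  d := 0
  π := LinearMap.id
  surjective := Function.surjective_id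
  exact := by
    rw [LinearMap.exact_iff, LinearMap.ker_id, LinearMap.range_zero]
  minimal₀ := fun L hL => by rwa [LinearMap.ker_id, sup_bot_eq] at hL
  minimal₁ := fun L _ => Subsingleton.elim (h := inferInstanceAs
    (Subsingleton (Submodule A PUnit.{u + 1}))) _ _

variable [Module.Finite K A]

/-- The transpose does not depend on the minimal projective presentation. -/
theorem transpose_iso (p q : MinProjPres M) : p.transpose.Iso q.transpose := by
  -- Both `P₀ → M` and, once the `P₀` are identified, both `P₁ → P₀` are right minimal with the
  -- same range.
  obtain ⟨e₀, h₀⟩ := p.isRightMinimal_π.exists_equiv p.projective₀ q.projective₀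
    q.isRightMinimal_π (by
      rw [LinearMap.range_eq_top.2 p.surjective, LinearMap.range_eq_top.2 q.surjective])
  have hp : IsRightMinimal (e₀.toLinearMap.comp p.d) := fun h hh =>
    p.isRightMinimal_d h (LinearMap.ext fun x => e₀.injective (LinearMap.congr_fun hh x))
  obtain ⟨e₁, h₁⟩ := hp.exists_equiv p.projective₁ q.projective₁ q.isRightMinimal_d (by
    rw [LinearMap.range_comp, ← p.ker_eq_range, ← q.ker_eq_range, ← h₀, LinearMap.ker_comp]
    exact Submodule.map_comap_eq_of_surjective e₀.surjective _)
  exact Iso.symm (coker_equiv (starMap q.d) (starMap p.d)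
    (LinearEquiv.ofBijective _ (starMap_bijective e₀.bijective))
    (LinearEquiv.ofBijective _ (starMap_bijective e₁.bijective))
    fun k => LinearMap.congr_fun (congrArg starMap h₁) k)

theorem tr_iso (p : MinProjPres M) : M.tr.Iso p.transpose := transpose_iso _ p

theorem transpose_sum (p : MinProjPres M) (q : MinProjPres N) :
    (p.sum q).transpose.Iso (p.transpose.sum q.transpose) := by
  have h1 := coker_equiv (starMap (p.sum q).d) ((starMap p.d).prodMap (starMap q.d))
    (LinearMap.coprodEquiv (R := A) (M := p.P₀) (M₂ := q.P₀) (M₃ := A) Aᵐᵒᵖ).symm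
    (LinearMap.coprodEquiv (R := A) (M := p.P₁) (M₂ := q.P₁) (M₃ := A) Aᵐᵒᵖ).symm
    fun (k : p.P₀ × q.P₀ →ₗ[A] A) => by
      refine Prod.ext (LinearMap.ext fun x => ?_) (LinearMap.ext fun x => ?_)
      · change k (p.d x, q.d 0) = k (p.d x, 0)
        rw [map_zero]
      · change k (p.d 0, q.d x) = k (0, q.d x)
        rw [map_zero]
  obtain ⟨e⟩ := h1
  obtain ⟨f⟩ := coker_prodMap_equiv (starMap p.d) (starMap q.d)
  exact ⟨e.trans f⟩

/-- The kernel of `P₁ → P₀` being superfluous, `P₀* → P₁*` is left minimal. -/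
theorem transpose_noProjSummand (p : MinProjPres M) : p.transpose.NoProjSummand :=
  (isLeftMinimal_iff (projective_star p.projective₁) _).1
    (p.isRightMinimal_d.star p.projective₁ p.projective₀)

/-- If `M` has no nonzero projective summand, then `P₀* → P₁* → Tr M → 0` is a minimal
projective presentation. -/
def star (p : MinProjPres M) (hM : M.NoProjSummand) : MinProjPres p.transpose where
  P₁ := p.P₀.star
  P₀ := p.P₁.star
  projective₁ := projective_star p.projective₀
  projective₀ := projective_star p.projective₁
  d := starMap p.d
  π := (LinearMap.range (starMap p.d)).mkQ
  surjective := Submodule.mkQ_surjective _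
  exact := fun _ => Submodule.Quotient.mk_eq_zero _
  minimal₀ := fun L hL => (isRadical_iff (projective_star p.projective₁) _).1
    (p.isRadical_d.star p.projective₁) L ((congrArg _ (Submodule.ker_mkQ _)).symm.trans hL)
  minimal₁ := (isRightMinimal_iff (projective_star p.projective₀) _).1
    (IsLeftMinimal.star p.projective₀ ((isLeftMinimal_iff p.projective₀ p.d).2
      (p.iso_coker.symm.noProjSummand hM)))

/-- The double transpose is the cokernel of `P₁** → P₀**`, hence of `P₁ → P₀`. -/
theorem star_transpose_iso (p : MinProjPres M) (hM : M.NoProjSummand) :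
    (p.star hM).transpose.ofOpOp.Iso M := by
  have h : (p.P₀.quotient (LinearMap.range p.d)).Iso (p.P₀.star.star.ofOpOp.quotient
      (LinearMap.range (ofOpOpMap (starMap (starMap p.d))))) :=
    coker_equiv p.d (ofOpOpMap (starMap (starMap p.d)))
    (LinearEquiv.ofBijective _ (evalStar_bijective p.projective₁))
    (LinearEquiv.ofBijective _ (evalStar_bijective p.projective₀)) fun _ => rfl
  exact (ofOpOp_coker (starMap (starMap p.d))).trans (h.symm.trans p.iso_coker)

end MinProjPres

section Tr

variable [Module.Finite K A]

theorem Iso.tr {M N : FDMod K A} : M.Iso N → M.tr.Iso N.tr := fun ⟨e⟩ =>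
  Iso.symm (((Classical.choice (nonempty_minProjPres M)).congr e).tr_iso)

theorem tr_sum (M N : FDMod K A) : (M.sum N).tr.Iso (M.tr.sum N.tr) :=
  ((Classical.choice (nonempty_minProjPres M)).sum
    (Classical.choice (nonempty_minProjPres N))).tr_iso.trans (MinProjPres.transpose_sum _ _)

theorem subsingleton_tr {M : FDMod K A} (hM : Module.Projective A M) : Subsingleton M.tr := by
  refine (MinProjPres.ofProjective hM).tr_iso.symm.subsingleton ?_
  have h : Subsingleton (PUnit.{u + 1} →ₗ[A] A) :=
    ⟨fun f g => LinearMap.ext fun x => by rw [Subsingleton.elim x 0, map_zero, map_zero]⟩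
  exact @Function.Surjective.subsingleton _ _ _ h
    (Submodule.mkQ_surjective (LinearMap.range (starMap (MinProjPres.ofProjective hM).d)))

theorem tr_noProjSummand (M : FDMod K A) : M.tr.NoProjSummand :=
  MinProjPres.transpose_noProjSummand _

theorem tr_tr_iso {M : FDMod K A} (hM : M.NoProjSummand) : M.tr.tr.ofOpOp.Iso M :=
  (((Classical.choice (nonempty_minProjPres M)).star hM).tr_iso.ofOpOp).trans
    (MinProjPres.star_transpose_iso _ hM)

end Tr

/-! ### Identification of `(Aᵒᵖ)ᵒᵖ`-modules with `A`-modules -/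

/-- An `A`-module, regarded as an `(Aᵒᵖ)ᵒᵖ`-module. -/
def toOpOp (M : FDMod K A) : FDMod K Aᵐᵒᵖᵐᵒᵖ :=
  letI : Module Aᵐᵒᵖᵐᵒᵖ M := Module.compHom M (RingEquiv.opOp A).symm.toRingHom
  { carrier := M
    isScalarTower := ⟨fun k a x => smul_assoc k a.unop.unop x⟩ }

theorem Iso.toOpOp {M N : FDMod K A} : M.Iso N → M.toOpOp.Iso N.toOpOp := fun ⟨e⟩ =>
  ⟨{ toFun := e
     invFun := e.symm
     map_add' := e.map_add
     map_smul' := fun a x => e.map_smul a.unop.unop x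
     left_inv := e.left_inv
     right_inv := e.right_inv }⟩

theorem summandCorrespondence_ofOpOp :
    SummandCorrespondence (fun _ : FDMod K Aᵐᵒᵖᵐᵒᵖ => True) (fun _ : FDMod K A => True)
      ofOpOp toOpOp where
  closed_left _ _ := trivial
  closed_right _ _ := trivial
  map_left _ := trivial
  map_right _ := trivial
  iso_left := Iso.ofOpOp
  iso_right := Iso.toOpOp
  sum_left M N := isoRefl (M.ofOpOp.sum N.ofOpOp)
  sum_right M N := isoRefl (M.toOpOp.sum N.toOpOp)
  left_inv {M} _ := isoRefl M
  right_inv {M} _ := isoRefl M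

theorem projective_ofOpOp {M : FDMod K Aᵐᵒᵖᵐᵒᵖ} (_ : Module.Projective Aᵐᵒᵖᵐᵒᵖ M) :
    Module.Projective A M.ofOpOp := by
  let σ := RingEquiv.opOp A
  have := RingHomInvPair.of_ringEquiv σ
  have := RingHomInvPair.symm (σ : A →+* Aᵐᵒᵖᵐᵒᵖ) (σ.symm : Aᵐᵒᵖᵐᵒᵖ →+* A)
  let e : M ≃ₛₗ[(σ.symm : Aᵐᵒᵖᵐᵒᵖ →+* A)] M.ofOpOp :=
    { toFun := fun x => x
      invFun := fun x => x
      map_add' := fun _ _ => rfl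
      map_smul' := fun _ _ => rfl
      left_inv := fun _ => rfl
      right_inv := fun _ => rfl }
  exact Module.Projective.of_equiv e

theorem projective_toOpOp {M : FDMod K A} (_ : Module.Projective A M) :
    Module.Projective Aᵐᵒᵖᵐᵒᵖ M.toOpOp := by
  let σ := RingEquiv.opOp A
  have := RingHomInvPair.of_ringEquiv σ
  have := RingHomInvPair.symm (σ : A →+* Aᵐᵒᵖᵐᵒᵖ) (σ.symm : Aᵐᵒᵖᵐᵒᵖ →+* A)
  let e : M ≃ₛₗ[(σ : A →+* Aᵐᵒᵖᵐᵒᵖ)] M.toOpOp :=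
    { toFun := fun x => x
      invFun := fun x => x
      map_add' := fun _ _ => rfl
      map_smul' := fun _ _ => rfl
      left_inv := fun _ => rfl
      right_inv := fun _ => rfl }
  exact Module.Projective.of_equiv e

theorem NoProjSummand.ofOpOp {M : FDMod K Aᵐᵒᵖᵐᵒᵖ} (h : M.NoProjSummand) :
    M.ofOpOp.NoProjSummand := fun Q hQ hQM =>
  h Q.toOpOp (projective_toOpOp hQ) (summandCorrespondence_ofOpOp.symm.isSummand hQM)

theorem dual_ofOpOp (M : FDMod K Aᵐᵒᵖᵐᵒᵖ) : M.dual.ofOpOp.Iso M.ofOpOp.dual :=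
  ⟨{ toFun := fun φ => φ
     invFun := fun φ => φ
     map_add' := fun _ _ => rfl
     map_smul' := fun _ _ => rfl
     left_inv := fun _ => rfl
     right_inv := fun _ => rfl }⟩

/-- A submodule of `M.ofOpOp`, regarded as a submodule of `M`. -/
def submoduleToOpOp {M : FDMod K Aᵐᵒᵖᵐᵒᵖ} (N : Submodule A M.ofOpOp) :
    Submodule Aᵐᵒᵖᵐᵒᵖ M where
  carrier := {x : M.ofOpOp | x ∈ N}
  add_mem' := N.add_mem
  zero_mem' := N.zero_mem
  smul_mem' a _ hx := N.smul_mem a.unop.unop hx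

theorem superfluous_ofOpOp {M N : FDMod K Aᵐᵒᵖᵐᵒᵖ} {f : M →ₗ[Aᵐᵒᵖᵐᵒᵖ] N}
    (h : ∀ L : Submodule Aᵐᵒᵖᵐᵒᵖ M, L ⊔ LinearMap.ker f = ⊤ → L = ⊤)
    (L : Submodule A M.ofOpOp) (hL : L ⊔ LinearMap.ker (ofOpOpMap f) = ⊤) : L = ⊤ := by
  have h1 : submoduleToOpOp L = ⊤ := by
    apply h
    rw [eq_top_iff]
    intro x _
    obtain ⟨y, hy, z, hz, hyz⟩ := Submodule.mem_sup.1 (hL ▸ Submodule.mem_top :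
      (show M.ofOpOp from x) ∈ L ⊔ LinearMap.ker (ofOpOpMap f))
    exact Submodule.mem_sup.2 ⟨y, (hy : y ∈ L), z, hz, hyz⟩
  rw [eq_top_iff]
  intro x _
  have hx : (show M from x) ∈ submoduleToOpOp L := h1 ▸ Submodule.mem_top
  exact hx

section Star

variable [Module.Finite K A]

/-- `Hom(-, A)` is compatible with the identification of `(Aᵒᵖ)ᵒᵖ` with `A`. -/
def starOfOpOp (M : FDMod K Aᵐᵒᵖᵐᵒᵖ) : M.star.ofOpOp ≃ₗ[Aᵐᵒᵖ] M.ofOpOp.star where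
  toFun f := ({ toFun := fun x => unop (unop (DFunLike.coe (F := M →ₗ[Aᵐᵒᵖᵐᵒᵖ] Aᵐᵒᵖᵐᵒᵖ) f x))
                map_add' := fun x y => congrArg (fun z => unop (unop z))
                  (LinearMap.map_add (show M →ₗ[Aᵐᵒᵖᵐᵒᵖ] Aᵐᵒᵖᵐᵒᵖ from f) x y)
                map_smul' := fun a x => congrArg (fun z => unop (unop z))
                  (LinearMap.map_smul (show M →ₗ[Aᵐᵒᵖᵐᵒᵖ] Aᵐᵒᵖᵐᵒᵖ from f) (op (op a)) x) } :
              M.ofOpOp →ₗ[A] A)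
  invFun f := ({ toFun := fun x => op (op (DFunLike.coe (F := M.ofOpOp →ₗ[A] A) f x))
                 map_add' := fun x y => congrArg (fun z => op (op z))
                  (LinearMap.map_add (show M.ofOpOp →ₗ[A] A from f) x y)
                 map_smul' := fun a x => congrArg (fun z => op (op z))
                  (LinearMap.map_smul (show M.ofOpOp →ₗ[A] A from f) a.unop.unop x) } :
              M →ₗ[Aᵐᵒᵖᵐᵒᵖ] Aᵐᵒᵖᵐᵒᵖ)
  map_add' _ _ := rfl
  map_smul' _ _ := rfl
  left_inv _ := rfl
  right_inv _ := rfl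

theorem star_ofOpOp (M : FDMod K Aᵐᵒᵖᵐᵒᵖ) : M.star.ofOpOp.Iso M.ofOpOp.star := ⟨starOfOpOp M⟩

/-- A minimal projective presentation over `(Aᵒᵖ)ᵒᵖ`, regarded as one over `A`. -/
def MinProjPres.ofOpOp {M : FDMod K Aᵐᵒᵖᵐᵒᵖ} (p : MinProjPres M) : MinProjPres M.ofOpOp where
  P₁ := p.P₁.ofOpOp
  P₀ := p.P₀.ofOpOp
  projective₁ := projective_ofOpOp p.projective₁
  projective₀ := projective_ofOpOp p.projective₀
  d := ofOpOpMap p.d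
  π := ofOpOpMap p.π
  surjective := p.surjective
  exact := p.exact
  minimal₀ := superfluous_ofOpOp p.minimal₀
  minimal₁ := superfluous_ofOpOp p.minimal₁

theorem tr_ofOpOp (M : FDMod K Aᵐᵒᵖᵐᵒᵖ) : M.tr.ofOpOp.Iso M.ofOpOp.tr := by
  let p := Classical.choice (nonempty_minProjPres M)
  have h : (p.P₁.star.ofOpOp.quotient (LinearMap.range (ofOpOpMap (starMap p.d)))).Iso
      p.ofOpOp.transpose := coker_equiv (ofOpOpMap (starMap p.d)) (starMap p.ofOpOp.d)
    (starOfOpOp p.P₀) (starOfOpOp p.P₁) fun _ => rfl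
  exact (ofOpOp_coker (starMap p.d)).trans (h.trans p.ofOpOp.tr_iso.symm)

end Star

/-! ### The standard duality -/

/-- The transpose of a map of modules. -/
def dualMap {M N : FDMod K A} (f : M →ₗ[A] N) : N.dual →ₗ[Aᵐᵒᵖ] M.dual where
  toFun φ := (show Module.Dual K N from φ).comp (f.restrictScalars K)
  map_add' _ _ := rfl
  map_smul' a φ := LinearMap.ext fun x =>
    congrArg (show Module.Dual K N from φ) (f.map_smul a.unop x).symm

theorem Iso.dual {M N : FDMod K A} : M.Iso N → M.dual.Iso N.dual := fun ⟨e⟩ =>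
  ⟨{ dualMap e.symm.toLinearMap with
     invFun := dualMap e.toLinearMap
     left_inv := fun φ => LinearMap.ext fun x =>
      congrArg (show Module.Dual K M from φ) (e.symm_apply_apply x)
     right_inv := fun φ => LinearMap.ext fun x =>
      congrArg (show Module.Dual K N from φ) (e.apply_symm_apply x) }⟩

theorem tau_ofOpOp [Module.Finite K A] (M : FDMod K Aᵐᵒᵖᵐᵒᵖ) : M.tau.ofOpOp.Iso M.ofOpOp.tau :=
  ((dual_ofOpOp M.tr).trans (Iso.dual (tr_ofOpOp M))).ofOpOp

theorem dual_sum (M N : FDMod K A) : (M.sum N).dual.Iso (M.dual.sum N.dual) :=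
  ⟨{ LinearMap.coprodEquiv (R := K) (M := M) (M₂ := N) (M₃ := K) K |>.symm.toAddEquiv with
     map_smul' := fun a φ => by
      refine Prod.ext (LinearMap.ext fun x => ?_) (LinearMap.ext fun x => ?_)
      · exact congrArg (show Module.Dual K (M × N) from φ) (Prod.ext rfl (smul_zero a.unop))
      · exact congrArg (show Module.Dual K (M × N) from φ) (Prod.ext (smul_zero a.unop) rfl) }⟩

/-- The evaluation isomorphism `M ≃ D D M`. -/
noncomputable def dualDualEquiv (M : FDMod K A) : M ≃ₗ[A] M.dual.dual.ofOpOp :=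
  { (Module.evalEquiv K M).toAddEquiv with map_smul' := fun _ _ => rfl }

theorem dual_dual_iso (M : FDMod K A) : M.dual.dual.ofOpOp.Iso M := ⟨(dualDualEquiv M).symm⟩

theorem summandCorrespondence_dual :
    SummandCorrespondence (fun _ : FDMod K A => True) (fun _ : FDMod K Aᵐᵒᵖ => True)
      dual (fun N => N.dual.ofOpOp) where
  closed_left _ _ := trivial
  closed_right _ _ := trivial
  map_left _ := trivial
  map_right _ := trivial
  iso_left := Iso.dual
  iso_right := fun e => e.dual.ofOpOp
  sum_left := dual_sum
  sum_right M N := (dual_sum M N).ofOpOp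
  left_inv {M} _ := dual_dual_iso M
  right_inv {M} _ := (dual_ofOpOp M.dual).symm.trans (dual_dual_iso M)

/-! ### Vanishing of homomorphisms -/

/-- `Hom_A(M, N) = 0`. -/
def HomZero (M N : FDMod K A) : Prop := ∀ f : M →ₗ[A] N, f = 0

theorem HomZero.congr {M M' N N' : FDMod K A} (h : HomZero M N) (hM : M.Iso M') (hN : N.Iso N') :
    HomZero M' N' := by
  obtain ⟨e⟩ := hM
  obtain ⟨e'⟩ := hN
  intro f
  have := h (e'.symm.toLinearMap.comp (f.comp e.toLinearMap))
  ext x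
  have h1 := LinearMap.congr_fun this (e.symm x)
  simpa using h1

theorem HomZero.summand_left {M M' N : FDMod K A} (h : HomZero M N) (hM : M'.IsSummand M) :
    HomZero M' N := by
  obtain ⟨Z, hZ⟩ := hM
  intro f
  have h1 := h.congr hZ (isoRefl N) (f.comp (LinearMap.fst A M' Z))
  ext x
  exact LinearMap.congr_fun h1 ((x, 0) : M' × Z)

theorem HomZero.summand_right {M N N' : FDMod K A} (h : HomZero M N) (hN : N'.IsSummand N) :
    HomZero M N' := by
  obtain ⟨Z, hZ⟩ := hN
  intro f
  have h1 := h.congr (isoRefl M) hZ ((LinearMap.inl A N' Z).comp f)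
  ext x
  exact congrArg Prod.fst (LinearMap.congr_fun h1 x)

theorem HomZero.sum_left {M M' N : FDMod K A} (h : HomZero M N) (h' : HomZero M' N) :
    HomZero (M.sum M') N := by
  intro f
  have h1 := h (f.comp (LinearMap.inl A M M'))
  have h2 := h' (f.comp (LinearMap.inr A M M'))
  exact LinearMap.prod_ext h1 h2

theorem HomZero.sum_right {M N N' : FDMod K A} (h : HomZero M N) (h' : HomZero M N') :
    HomZero M (N.sum N') := by
  intro f
  ext x
  exact Prod.ext (LinearMap.congr_fun (h ((LinearMap.fst A N N').comp f)) x)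
    (LinearMap.congr_fun (h' ((LinearMap.snd A N N').comp f)) x)

theorem HomZero.ofOpOp {M N : FDMod K Aᵐᵒᵖᵐᵒᵖ} (h : HomZero M N) :
    HomZero M.ofOpOp N.ofOpOp := fun f => by
  let g : M →ₗ[Aᵐᵒᵖᵐᵒᵖ] N :=
    { toFun := f, map_add' := f.map_add, map_smul' := fun a x => f.map_smul a.unop.unop x }
  have := h g
  ext x
  exact LinearMap.congr_fun this x

/-- Both the hypothesis and the conclusion express the vanishing of all bilinear maps
`β : N × M → K` with `β (n a, m) = β (n, a m)`. -/
theorem HomZero.flip {M : FDMod K A} {N : FDMod K Aᵐᵒᵖ} (h : HomZero M N.dual.ofOpOp) :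
    HomZero N M.dual := by
  intro g
  let β : N →ₗ[K] M →ₗ[K] K := g.restrictScalars K
  have hβ : ∀ n m (a : A), β (op a • n) m = β n (a • m) := fun n m a =>
    LinearMap.congr_fun (show (g (op a • n) : Module.Dual K M) = _ from g.map_smul (op a) n) m
  let f : M →ₗ[A] N.dual.ofOpOp :=
    { toFun := fun m => β.flip m
      map_add' := fun x y => map_add β.flip x y
      map_smul' := fun a m => LinearMap.ext fun n => (hβ n m a).symm }
  refine LinearMap.ext fun n => LinearMap.ext fun m => ?_
  exact LinearMap.congr_fun (show (f m : Module.Dual K N) = (0 : Module.Dual K N) from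
    LinearMap.congr_fun (h f) m) n

theorem HomZero.unflip {M : FDMod K A} {N : FDMod K Aᵐᵒᵖ} (h : HomZero N M.dual) :
    HomZero M N.dual.ofOpOp :=
  (HomZero.flip (M := N) (N := M.toOpOp) (h.congr (isoRefl N)
    ((dual_ofOpOp M.toOpOp).symm))).ofOpOp

theorem HomZero.dual {M N : FDMod K A} (h : HomZero M N) : HomZero N.dual M.dual :=
  HomZero.flip (h.congr (isoRefl M) (dual_dual_iso N).symm)

theorem HomZero.of_dual {M N : FDMod K A} (h : HomZero N.dual M.dual) : HomZero M N :=
  h.unflip.congr (isoRefl M) (dual_dual_iso N)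

section Star

variable [Module.Finite K A]

/-- For projective `P`, both `Hom(P, D N) = 0` and `Hom(P*, N) = 0` say that the trace ideal of
`P`, spanned by the values `f p` with `f ∈ P*` and `p ∈ P`, annihilates `N`. -/
theorem HomZero.star_left {P : FDMod K A} {N : FDMod K Aᵐᵒᵖ} (hP : Module.Projective A P)
    (h : HomZero P N.dual.ofOpOp) : HomZero P.star N := by
  have h1 : ∀ (f : P →ₗ[A] A) (p : P) (n : N), op (f p) • n = 0 := by
    intro f p n
    refine (Module.forall_dual_apply_eq_zero_iff K _).1 fun φ => ?_
    have h2 := LinearMap.congr_fun (h ((LinearMap.toSpanSingleton A N.dual.ofOpOp φ).comp f)) p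
    exact LinearMap.congr_fun (show ((f p • (show N.dual.ofOpOp from φ) : N.dual.ofOpOp) :
      Module.Dual K N) = (0 : Module.Dual K N) from h2) n
  obtain ⟨n, p, f, hf⟩ := exists_dualBasis P hP
  intro g
  refine LinearMap.ext fun k : P →ₗ[A] A => ?_
  let g' : (P →ₗ[A] A) →ₗ[Aᵐᵒᵖ] N := g
  change g' k = 0
  rw [← star_dualBasis hf k, map_sum]
  exact Finset.sum_eq_zero fun i _ => by rw [map_smul, h1]

theorem HomZero.star {P Q : FDMod K A} (hQ : Module.Projective A Q) (h : HomZero P Q) :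
    HomZero Q.star P.star := by
  intro g
  obtain ⟨g', rfl⟩ := starMap_surjective hQ g
  rw [h g']
  exact LinearMap.ext fun k : Q →ₗ[A] A => LinearMap.ext fun _ => k.map_zero

end Star

/-! ### Injective modules and simple modules under the duality -/

/-- A projective cover of `D I` dualises to an embedding of `I`, which splits. -/
theorem projective_dual {I : FDMod K A} [Module.Finite K A] (_ : Module.Injective A I) :
    Module.Projective Aᵐᵒᵖ I.dual := by
  obtain ⟨P, π, hP, hπ, -⟩ := exists_projCover I.dual
  obtain ⟨e⟩ := (dual_dual_iso I).symm
  let i : I →ₗ[A] P.dual.ofOpOp := (ofOpOpMap (dualMap π)).comp e.toLinearMap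
  have hi : Function.Injective i := by
    refine Function.Injective.comp (g := dualMap π) ?_ e.injective
    intro φ ψ h
    refine LinearMap.ext fun y => ?_
    obtain ⟨x, rfl⟩ := hπ y
    exact LinearMap.congr_fun (show (dualMap π φ : Module.Dual K P) = dualMap π ψ from h) x
  obtain ⟨r, hr⟩ := Module.Injective.out i hi LinearMap.id
  have hsum := equiv_prod_ker_of_retraction i r hr
  have hs : I.IsSummand P.dual.ofOpOp := ⟨P.dual.ofOpOp.ofSubmodule (LinearMap.ker r), hsum⟩
  exact ((summandCorrespondence_dual.isSummand hs).iso_right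
    (summandCorrespondence_dual.right_inv trivial)).projective hP

theorem injective_of_projective_dual {I : FDMod K A} [Module.Finite K A]
    (hI : Module.Projective Aᵐᵒᵖ I.dual) : Module.Injective A I := by
  apply Module.Baer.injective
  intro J g
  -- Dualise the extension problem for `J ⊆ A` and use that `D A → D J` is surjective.
  let M : FDMod K A := { carrier := A }
  let N : FDMod K A := M.ofSubmodule J
  let ι : N →ₗ[A] M := J.subtype
  have hs : Function.Surjective (dualMap ι) := by
    intro φ
    obtain ⟨ψ, hψ⟩ := LinearMap.exists_extend (p := J.restrictScalars K)
      (show J.restrictScalars K →ₗ[K] K from φ)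
    exact ⟨ψ, hψ⟩
  obtain ⟨l, hl⟩ := Module.projective_lifting_property (dualMap ι) (dualMap (M := N) (N := I) g) hs
  refine ⟨(dualDualEquiv I).symm.toLinearMap.comp
    ((ofOpOpMap (dualMap l)).comp (dualDualEquiv M).toLinearMap), fun a ha => ?_⟩
  apply (dualDualEquiv I).injective
  refine ((dualDualEquiv I).apply_symm_apply _).trans (LinearMap.ext fun φ => ?_)
  exact LinearMap.congr_fun (show ((dualMap ι (l φ) : N.dual) : Module.Dual K N) =
    dualMap (M := N) (N := I) g φ from LinearMap.congr_fun hl φ) ⟨a, ha⟩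

theorem isSimpleModule_dual {M : FDMod K A} (hM : IsSimpleModule A M) :
    IsSimpleModule Aᵐᵒᵖ M.dual := by
  have := IsSimpleModule.nontrivial A M
  have hnt : Nontrivial M.dual := inferInstanceAs (Nontrivial (Module.Dual K M))
  rw [isSimpleModule_iff]
  refine { (Submodule.nontrivial_iff _).2 hnt with eq_bot_or_eq_top := fun L => ?_ }
  -- The common kernel of the functionals in `L` is a submodule of `M`.
  let L' : Submodule K (Module.Dual K M) := L.restrictScalars K
  let C : Submodule A M :=
    { L'.dualCoannihilator with
      smul_mem' := fun a x hx => (Submodule.mem_dualCoannihilator _).2 fun φ hφ =>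
        (Submodule.mem_dualCoannihilator _).1 hx _ (L.smul_mem (op a) hφ) }
  have hC : ∀ x, x ∈ C ↔ ∀ φ ∈ L', φ x = 0 := fun x => Submodule.mem_dualCoannihilator x
  rcases eq_bot_or_eq_top C with h | h
  · right
    have h1 : L'.dualCoannihilator = ⊥ :=
      (Submodule.eq_bot_iff _).2 fun x hx => (Submodule.eq_bot_iff C).1 h x hx
    have h2 := Subspace.dualCoannihilator_dualAnnihilator_eq (W := L')
    rw [h1, Submodule.dualAnnihilator_bot] at h2
    refine eq_top_iff.2 fun (φ : Module.Dual K M) _ => ?_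
    have hφ : φ ∈ L' := h2 ▸ Submodule.mem_top
    exact hφ
  · left
    refine (Submodule.eq_bot_iff L).2 fun φ hφ => LinearMap.ext fun x => ?_
    exact (hC x).1 (h ▸ Submodule.mem_top) φ hφ

theorem isSimpleModule_ofOpOp {M : FDMod K Aᵐᵒᵖᵐᵒᵖ} (hM : IsSimpleModule Aᵐᵒᵖᵐᵒᵖ M) :
    IsSimpleModule A M.ofOpOp := by
  have hnt : Nontrivial M.ofOpOp := IsSimpleModule.nontrivial Aᵐᵒᵖᵐᵒᵖ M
  rw [isSimpleModule_iff]
  refine { (Submodule.nontrivial_iff _).2 hnt with eq_bot_or_eq_top := fun L => ?_ }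
  rcases eq_bot_or_eq_top (submoduleToOpOp L) with h | h
  · left
    exact (Submodule.eq_bot_iff L).2 ((Submodule.eq_bot_iff (submoduleToOpOp L)).1 h)
  · right
    refine eq_top_iff.2 fun x _ => ?_
    have hx : (show M from x) ∈ submoduleToOpOp L := h ▸ Submodule.mem_top
    exact hx

end FDMod

/-- The standard duality is a bijection between the isomorphism classes of simple modules. -/
theorem numVertices_op : numVertices K Aᵐᵒᵖ = numVertices K A := by
  apply le_antisymm
  · refine Set.encard_le_encard_of_injOn (f := Quotient.map (fun M : FDMod K Aᵐᵒᵖ => M.dual.ofOpOp)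
      fun _ _ e => FDMod.Iso.ofOpOp (FDMod.Iso.dual e)) ?_ ?_
    · rintro _ ⟨S, hS, rfl⟩
      exact ⟨_, FDMod.isSimpleModule_ofOpOp (FDMod.isSimpleModule_dual hS), rfl⟩
    · rintro _ ⟨S, hS, rfl⟩ _ ⟨S', hS', rfl⟩ h
      have e : S.dual.ofOpOp.Iso S'.dual.ofOpOp := Quotient.exact h
      have hc := FDMod.summandCorrespondence_dual (K := K) (A := A)
      exact Quotient.sound ((hc.right_inv trivial).symm.trans (e.dual.trans (hc.right_inv trivial)))
  · refine Set.encard_le_encard_of_injOn (f := Quotient.map FDMod.dual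
      fun _ _ e => FDMod.Iso.dual e) ?_ ?_
    · rintro _ ⟨S, hS, rfl⟩
      exact ⟨_, FDMod.isSimpleModule_dual hS, rfl⟩
    · rintro _ ⟨S, hS, rfl⟩ _ ⟨S', hS', rfl⟩ h
      have e : S.dual.Iso S'.dual := Quotient.exact h
      exact Quotient.sound ((FDMod.dual_dual_iso S).symm.trans
        (e.dual.ofOpOp.trans (FDMod.dual_dual_iso S')))

namespace FDMod

/-! ### Projective parts -/

namespace IsProjDecomp

variable {T Tpr Tnp T' Tpr' Tnp' : FDMod K A}

theorem noProjSummand (h : T.IsProjDecomp Tpr Tnp) : Tnp.NoProjSummand := h.2.2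

theorem iso_fst (h : T.IsProjDecomp Tpr Tnp) (h' : T'.IsProjDecomp Tpr' Tnp') (e : T.Iso T') :
    Tpr.Iso Tpr' :=
  projective_part_iso h.2.1 h'.2.1 h.2.2 h'.2.2 (h.1.symm.trans (e.trans h'.1))

theorem isSummand_fst (h : T.IsProjDecomp Tpr Tnp) : Tpr.IsSummand T := ⟨Tnp, h.1⟩

theorem isSummand_snd (h : T.IsProjDecomp Tpr Tnp) : Tnp.IsSummand T :=
  ⟨Tpr, h.1.trans (sumComm _ _)⟩

theorem numSummands_eq (h : T.IsProjDecomp Tpr Tnp) :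
    T.numSummands = Tnp.numSummands + Tpr.numSummands :=
  (numSummands_congr (h.1.trans (sumComm _ _))).trans (numSummands_sum h.2.2 h.2.1)

theorem tr_iso [Module.Finite K A] (h : T.IsProjDecomp Tpr Tnp) : T.tr.Iso Tnp.tr :=
  (Iso.tr h.1).trans ((tr_sum Tpr Tnp).trans (sum_iso_right _ _ (subsingleton_tr h.2.1)))

end IsProjDecomp

/-- A maximal projective summand of `T`. -/
noncomputable def projPart (T : FDMod K A) : FDMod K A := (exists_isProjDecomp T).choose

theorem exists_isProjDecomp_projPart (T : FDMod K A) : ∃ Tnp, T.IsProjDecomp T.projPart Tnp :=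
  (exists_isProjDecomp T).choose_spec

theorem Iso.projPart {T T' : FDMod K A} (e : T.Iso T') : T.projPart.Iso T'.projPart :=
  let ⟨_, h⟩ := exists_isProjDecomp_projPart T
  let ⟨_, h'⟩ := exists_isProjDecomp_projPart T'
  h.iso_fst h' e

theorem IsProjDecomp.iso_projPart {T Tpr Tnp : FDMod K A} (h : T.IsProjDecomp Tpr Tnp) :
    Tpr.Iso T.projPart :=
  let ⟨_, h'⟩ := exists_isProjDecomp_projPart T
  h.iso_fst h' (isoRefl T)

theorem IsProjDecomp.ofOpOp {T Tpr Tnp : FDMod K Aᵐᵒᵖᵐᵒᵖ} (h : T.IsProjDecomp Tpr Tnp) :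
    T.ofOpOp.IsProjDecomp Tpr.ofOpOp Tnp.ofOpOp :=
  ⟨Iso.ofOpOp h.1, projective_ofOpOp h.2.1, NoProjSummand.ofOpOp h.2.2⟩

/-- The duality turns maximal injective summands into maximal projective summands. -/
theorem IsInjDecomp.dual [Module.Finite K A] {Y Yin Yni : FDMod K A}
    (h : Y.IsInjDecomp Yin Yni) : Y.dual.IsProjDecomp Yin.dual Yni.dual := by
  have hc := summandCorrespondence_dual (K := K) (A := A)
  refine ⟨(Iso.dual h.1).trans (dual_sum _ _), projective_dual h.2.1, fun Q hQ hQY => ?_⟩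
  have hs := h.2.2 Q.dual.ofOpOp
    (injective_of_projective_dual (((hc.right_inv (M := Q) trivial).symm).projective hQ))
    ((hc.symm.isSummand hQY).iso_right (hc.left_inv trivial))
  exact (hc.right_inv (M := Q) trivial).subsingleton (hc.subsingleton hs)

section Star

variable [Module.Finite K A]

theorem summandCorrespondence_star :
    SummandCorrespondence (fun P : FDMod K A => Module.Projective A P)
      (fun P : FDMod K Aᵐᵒᵖ => Module.Projective Aᵐᵒᵖ P) star (fun P => P.star.ofOpOp) where
  closed_left h hX := hX.projective h
  closed_right h hX := hX.projective h
  map_left := projective_star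
  map_right h := projective_ofOpOp (projective_star h)
  iso_left := Iso.star
  iso_right e := e.star.ofOpOp
  sum_left := star_sum
  sum_right M N := (star_sum M N).ofOpOp
  left_inv := star_star_iso
  right_inv {P} h := (star_ofOpOp P.star).symm.trans (star_star_iso h)

theorem summandCorrespondence_tr :
    SummandCorrespondence (fun M : FDMod K A => M.NoProjSummand)
      (fun M : FDMod K Aᵐᵒᵖ => M.NoProjSummand) tr (fun M => M.tr.ofOpOp) where
  closed_left h hX := h.summand hX
  closed_right h hX := h.summand hX
  map_left _ := tr_noProjSummand _
  map_right _ := (tr_noProjSummand _).ofOpOp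
  iso_left := Iso.tr
  iso_right e := (Iso.tr e).ofOpOp
  sum_left := tr_sum
  sum_right M N := (tr_sum M N).ofOpOp
  left_inv := tr_tr_iso
  right_inv {M} h := (tr_ofOpOp M.tr).symm.trans (tr_tr_iso h)

theorem Iso.tau {M N : FDMod K A} (e : M.Iso N) : M.tau.Iso N.tau :=
  (Iso.dual (Iso.tr e)).ofOpOp

theorem isProjDecomp_tr_sum_star (T : FDMod K A) {P : FDMod K A} (hP : Module.Projective A P) :
    (T.tr.sum P.star).IsProjDecomp P.star T.tr :=
  ⟨sumComm _ _, projective_star hP, tr_noProjSummand T⟩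

end Star

end FDMod

/-! ### Pairs of modules -/

namespace ModPair

open FDMod

/-- Isomorphism of pairs. -/
def Iso (X Y : ModPair K A) : Prop := X.fst.Iso Y.fst ∧ X.snd.Iso Y.snd

theorem Iso.symm {X Y : ModPair K A} (h : X.Iso Y) : Y.Iso X := ⟨h.1.symm, h.2.symm⟩

theorem Iso.trans {X Y Z : ModPair K A} (h : X.Iso Y) (h' : Y.Iso Z) : X.Iso Z :=
  ⟨h.1.trans h'.1, h.2.trans h'.2⟩

theorem cls_eq_iff {X Y : ModPair K A} : X.cls = Y.cls ↔ X.Iso Y :=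
  ⟨fun h => Quotient.exact h, fun h => Quotient.sound h⟩

/-- The number of isomorphism classes of indecomposable summands of both components. -/
noncomputable def size (X : ModPair K A) : ℕ∞ := X.fst.numSummands + X.snd.numSummands

theorem Iso.ofOpOp {X Y : ModPair K Aᵐᵒᵖᵐᵒᵖ} (h : X.Iso Y) : X.ofOpOp.Iso Y.ofOpOp :=
  ⟨FDMod.Iso.ofOpOp h.1, FDMod.Iso.ofOpOp h.2⟩

theorem Iso.dual {X Y : ModPair K A} (h : X.Iso Y) : X.dual.Iso Y.dual :=
  ⟨FDMod.Iso.dual h.1, FDMod.Iso.dual h.2⟩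

theorem IsBasic.ofOpOp {X : ModPair K Aᵐᵒᵖᵐᵒᵖ} (h : X.IsBasic) : X.ofOpOp.IsBasic :=
  ⟨summandCorrespondence_ofOpOp.isBasic trivial h.1,
    summandCorrespondence_ofOpOp.isBasic trivial h.2⟩

theorem size_ofOpOp (X : ModPair K Aᵐᵒᵖᵐᵒᵖ) : X.ofOpOp.size = X.size :=
  congrArg₂ _ (summandCorrespondence_ofOpOp.numSummands_eq trivial)
    (summandCorrespondence_ofOpOp.numSummands_eq trivial)

theorem IsBasic.dual {X : ModPair K A} (h : X.IsBasic) : X.dual.IsBasic :=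
  ⟨summandCorrespondence_dual.isBasic trivial h.1, summandCorrespondence_dual.isBasic trivial h.2⟩

theorem size_dual (X : ModPair K A) : X.dual.size = X.size :=
  congrArg₂ _ (summandCorrespondence_dual.numSummands_eq trivial)
    (summandCorrespondence_dual.numSummands_eq trivial)

theorem dual_dual_iso (X : ModPair K A) : X.dual.dual.ofOpOp.Iso X :=
  ⟨FDMod.dual_dual_iso _, FDMod.dual_dual_iso _⟩

theorem dual_ofOpOp_dual_iso (Y : ModPair K Aᵐᵒᵖ) : Y.dual.ofOpOp.dual.Iso Y :=
  ⟨summandCorrespondence_dual.right_inv trivial, summandCorrespondence_dual.right_inv trivial⟩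

variable [Module.Finite K A]

theorem IsTauRigid.iso {X Y : ModPair K A} (hX : X.IsTauRigid) (h : X.Iso Y) : Y.IsTauRigid :=
  ⟨HomZero.congr hX.1 h.1 h.1.tau, h.2.projective hX.2.1, HomZero.congr hX.2.2 h.2 h.1⟩

theorem IsTauRigid.ofOpOp {X : ModPair K Aᵐᵒᵖᵐᵒᵖ} (hX : X.IsTauRigid) : X.ofOpOp.IsTauRigid :=
  ⟨(HomZero.ofOpOp hX.1).congr (isoRefl _) (tau_ofOpOp _), projective_ofOpOp hX.2.1,
    HomZero.ofOpOp hX.2.2⟩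

/-- A pair is `τ⁻`-rigid exactly when its dual is `τ`-rigid, since `τ D U ≅ D τ⁻ U`. -/
theorem isTauRigid_dual_iff {X : ModPair K A} : X.dual.IsTauRigid ↔ X.IsTauMinusRigid := by
  have e : X.fst.dual.tau.Iso X.fst.tauMinus.dual := dual_ofOpOp _
  constructor
  · rintro ⟨h1, h2, h3⟩
    exact ⟨(HomZero.congr h1 (isoRefl _) e).of_dual, injective_of_projective_dual h2,
      HomZero.of_dual h3⟩
  · rintro ⟨h1, h2, h3⟩
    exact ⟨HomZero.congr (HomZero.dual h1) (isoRefl _) e.symm, projective_dual h2,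
      HomZero.dual h3⟩

/-- The pair `(T, P)† = (Tr T ⊕ P*, T_pr*)`. -/
noncomputable def dagger (X : ModPair K A) : ModPair K Aᵐᵒᵖ :=
  ⟨X.fst.tr.sum X.snd.star, X.fst.projPart.star⟩

theorem Iso.dagger {X Y : ModPair K A} (h : X.Iso Y) : X.dagger.Iso Y.dagger :=
  ⟨(Iso.tr h.1).sum h.2.star, h.1.projPart.star⟩

theorem dagger_iso {T P Tpr Tnp : FDMod K A} (h : T.IsProjDecomp Tpr Tnp) :
    (dagger ⟨T, P⟩).Iso ⟨T.tr.sum P.star, Tpr.star⟩ :=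
  ⟨isoRefl _, h.iso_projPart.symm.star⟩

theorem dagger_ofOpOp (X : ModPair K Aᵐᵒᵖᵐᵒᵖ) : X.dagger.ofOpOp.Iso X.ofOpOp.dagger := by
  obtain ⟨N, h⟩ := exists_isProjDecomp_projPart X.fst
  exact ⟨(tr_ofOpOp _).sum (star_ofOpOp _), (star_ofOpOp _).trans h.ofOpOp.iso_projPart.star⟩

/-- `Tr` is an involution on `T_np` and `(-)*` on `T_pr` and `P`, and `P*` is the maximal projective
summand of `Tr T ⊕ P*`. -/
theorem dagger_dagger_iso {X : ModPair K A} (hX : Module.Projective A X.snd) :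
    X.dagger.dagger.ofOpOp.Iso X := by
  obtain ⟨N, h⟩ := exists_isProjDecomp_projPart X.fst
  have hpr := (isProjDecomp_tr_sum_star X.fst hX).iso_projPart
  have h1 : (X.fst.tr.sum X.snd.star).tr.ofOpOp.Iso N :=
    (FDMod.Iso.ofOpOp ((isProjDecomp_tr_sum_star X.fst hX).tr_iso.trans (Iso.tr h.tr_iso))).trans
      (tr_tr_iso h.noProjSummand)
  exact ⟨(h1.sum (star_star_iso h.2.1)).trans ((sumComm _ _).trans h.1.symm),
    (hpr.symm.star.ofOpOp).trans (star_star_iso hX)⟩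

/-- With `τ Tr T ≅ D T_np`, all vanishing conditions for `(T, P)†` are obtained from those for
`(T, P)` by adjunction and by the trace ideal argument. -/
theorem IsTauRigid.dagger {X : ModPair K A} (hX : X.IsTauRigid) : X.dagger.IsTauRigid := by
  obtain ⟨h1, h2, h3⟩ := hX
  obtain ⟨N, h⟩ := exists_isProjDecomp_projPart X.fst
  have htr : (X.fst.tr.sum X.snd.star).tr.Iso N.tr.tr :=
    (isProjDecomp_tr_sum_star X.fst h2).tr_iso.trans (Iso.tr h.tr_iso)
  have hτ : (X.fst.tr.sum X.snd.star).tau.Iso N.dual :=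
    (FDMod.Iso.dual htr).ofOpOp.trans
      ((dual_ofOpOp _).trans (FDMod.Iso.dual (tr_tr_iso h.noProjSummand)))
  have hP : HomZero X.snd.star X.fst.dual :=
    HomZero.star_left h2 (HomZero.congr h3 (isoRefl _) (FDMod.dual_dual_iso _).symm)
  refine ⟨HomZero.congr (HomZero.sum_left ?_ ?_) (isoRefl _) hτ.symm, projective_star h.2.1,
    HomZero.sum_right ?_ ?_⟩
  · -- `Hom(Tr T, D T_np)` is adjoint to `Hom(T_np, τ T)`.
    exact HomZero.flip (HomZero.summand_left h1 h.isSummand_snd)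
  · exact hP.summand_right (summandCorrespondence_dual.isSummand h.isSummand_snd)
  · -- `Hom(T_pr, τ T) = 0` gives `Hom(T_pr*, Tr T) = 0`.
    exact HomZero.star_left h.2.1 (HomZero.summand_left h1 h.isSummand_fst)
  · exact HomZero.star h.2.1 (HomZero.summand_right h3 h.isSummand_fst)

theorem IsBasic.dagger {X : ModPair K A} (hX : X.IsBasic) (hP : Module.Projective A X.snd) :
    X.dagger.IsBasic := by
  obtain ⟨N, h⟩ := exists_isProjDecomp_projPart X.fst
  refine ⟨IsBasic.sum ?_ (summandCorrespondence_star.isBasic hP hX.2) (tr_noProjSummand _)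
    (projective_star hP),
    summandCorrespondence_star.isBasic h.2.1 (hX.1.summand h.isSummand_fst)⟩
  exact (summandCorrespondence_tr.isBasic h.noProjSummand (hX.1.summand h.isSummand_snd)).iso
    h.tr_iso.symm

theorem size_dagger {X : ModPair K A} (hP : Module.Projective A X.snd) :
    X.dagger.size = X.size := by
  obtain ⟨N, h⟩ := exists_isProjDecomp_projPart X.fst
  have h1 : X.dagger.fst.numSummands = N.numSummands + X.snd.numSummands := by
    refine (numSummands_sum (tr_noProjSummand _) (projective_star hP)).trans ?_
    rw [summandCorrespondence_star.numSummands_eq hP, numSummands_congr h.tr_iso,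
      summandCorrespondence_tr.numSummands_eq h.noProjSummand]
  have h2 : X.dagger.snd.numSummands = X.fst.projPart.numSummands :=
    summandCorrespondence_star.numSummands_eq h.2.1
  rw [size, size, h1, h2, h.numSummands_eq, add_right_comm]

end ModPair

/-! ### Bijections between isomorphism classes -/

section Classes

open ModPair

variable [Module.Finite K A]

/-- The operation `(-)†` on isomorphism classes of pairs. -/
noncomputable def daggerCls : ModPair.IsoClass K A → ModPair.IsoClass K Aᵐᵒᵖ :=
  Quotient.map dagger fun _ _ h => Iso.dagger h

/-- Isomorphism classes of `(Aᵒᵖ)ᵒᵖ`-pairs, regarded as isomorphism classes of `A`-pairs. -/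
def ofOpOpCls : ModPair.IsoClass K Aᵐᵒᵖᵐᵒᵖ → ModPair.IsoClass K A :=
  Quotient.map ModPair.ofOpOp fun _ _ h => Iso.ofOpOp h

/-- The standard duality on isomorphism classes of pairs. -/
def dualCls : ModPair.IsoClass K A → ModPair.IsoClass K Aᵐᵒᵖ :=
  Quotient.map ModPair.dual fun _ _ h => Iso.dual h

theorem daggerCls_mem {c : ModPair.IsoClass K A} (hc : c ∈ tauRigidClasses K A) :
    daggerCls c ∈ tauRigidClasses K Aᵐᵒᵖ :=
  let ⟨X, hb, hr, h⟩ := hc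
  ⟨X.dagger, hb.dagger hr.2.1, hr.dagger, congrArg daggerCls h⟩

theorem ofOpOpCls_mem {c : ModPair.IsoClass K Aᵐᵒᵖᵐᵒᵖ} (hc : c ∈ tauRigidClasses K Aᵐᵒᵖᵐᵒᵖ) :
    ofOpOpCls c ∈ tauRigidClasses K A :=
  let ⟨X, hb, hr, h⟩ := hc
  ⟨X.ofOpOp, hb.ofOpOp, hr.ofOpOp, congrArg ofOpOpCls h⟩

theorem dualCls_mem {c : ModPair.IsoClass K A} (hc : c ∈ tauMinusRigidClasses K A) :
    dualCls c ∈ tauRigidClasses K Aᵐᵒᵖ :=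
  let ⟨X, hb, hr, h⟩ := hc
  ⟨X.dual, hb.dual, isTauRigid_dual_iff.2 hr, congrArg dualCls h⟩

theorem ofOpOpCls_dualCls_mem {c : ModPair.IsoClass K Aᵐᵒᵖ} (hc : c ∈ tauRigidClasses K Aᵐᵒᵖ) :
    ofOpOpCls (dualCls c) ∈ tauMinusRigidClasses K A :=
  let ⟨Y, hb, hr, h⟩ := hc
  ⟨Y.dual.ofOpOp, hb.dual.ofOpOp, isTauRigid_dual_iff.1 (hr.iso (dual_ofOpOp_dual_iso Y).symm),
    congrArg (fun c => ofOpOpCls (dualCls c)) h⟩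

theorem daggerCls_mem_support {c : ModPair.IsoClass K A}
    (hc : c ∈ supportTauTiltingClasses K A) : daggerCls c ∈ supportTauTiltingClasses K Aᵐᵒᵖ :=
  let ⟨X, hb, ⟨hr, hs⟩, h⟩ := hc
  ⟨X.dagger, hb.dagger hr.2.1,
    ⟨hr.dagger, (size_dagger hr.2.1).trans (hs.trans numVertices_op.symm)⟩, congrArg daggerCls h⟩

theorem ofOpOpCls_mem_support {c : ModPair.IsoClass K Aᵐᵒᵖᵐᵒᵖ}
    (hc : c ∈ supportTauTiltingClasses K Aᵐᵒᵖᵐᵒᵖ) :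
    ofOpOpCls c ∈ supportTauTiltingClasses K A :=
  let ⟨X, hb, ⟨hr, hs⟩, h⟩ := hc
  ⟨X.ofOpOp, hb.ofOpOp,
    ⟨hr.ofOpOp, (size_ofOpOp X).trans (hs.trans (numVertices_op.trans numVertices_op))⟩,
    congrArg ofOpOpCls h⟩

theorem dualCls_mem_support {c : ModPair.IsoClass K A}
    (hc : c ∈ supportTauMinusTiltingClasses K A) :
    dualCls c ∈ supportTauTiltingClasses K Aᵐᵒᵖ :=
  let ⟨X, hb, ⟨hr, hs⟩, h⟩ := hc
  ⟨X.dual, hb.dual,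
    ⟨isTauRigid_dual_iff.2 hr, (size_dual X).trans (hs.trans numVertices_op.symm)⟩,
    congrArg dualCls h⟩

theorem ofOpOpCls_dualCls_mem_support {c : ModPair.IsoClass K Aᵐᵒᵖ}
    (hc : c ∈ supportTauTiltingClasses K Aᵐᵒᵖ) :
    ofOpOpCls (dualCls c) ∈ supportTauMinusTiltingClasses K A :=
  let ⟨Y, hb, ⟨hr, hs⟩, h⟩ := hc
  ⟨Y.dual.ofOpOp, hb.dual.ofOpOp,
    ⟨isTauRigid_dual_iff.1 (hr.iso (dual_ofOpOp_dual_iso Y).symm),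
      (size_ofOpOp _).trans ((size_dual Y).trans (hs.trans numVertices_op))⟩,
    congrArg (fun c => ofOpOpCls (dualCls c)) h⟩

theorem daggerCls_daggerCls {c : ModPair.IsoClass K A} (hc : c ∈ tauRigidClasses K A) :
    ofOpOpCls (daggerCls (daggerCls c)) = c := by
  obtain ⟨X, -, hr, rfl⟩ := hc
  exact Quotient.sound (dagger_dagger_iso hr.2.1)

theorem daggerCls_ofOpOpCls (c : ModPair.IsoClass K Aᵐᵒᵖᵐᵒᵖ) :
    daggerCls (ofOpOpCls c) = ofOpOpCls (daggerCls c) := by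
  induction c using Quotient.ind with
  | _ X => exact Quotient.sound (dagger_ofOpOp X).symm

variable (K A) in
/-- The bijection `(-)†` between basic `τ`-rigid pairs over `A` and over `Aᵒᵖ`. -/
noncomputable def daggerEquiv : tauRigidClasses K A ≃ tauRigidClasses K Aᵐᵒᵖ where
  toFun x := ⟨daggerCls x.1, daggerCls_mem x.2⟩
  invFun y := ⟨ofOpOpCls (daggerCls y.1), ofOpOpCls_mem (daggerCls_mem y.2)⟩
  left_inv x := Subtype.ext (daggerCls_daggerCls x.2)
  right_inv y := Subtype.ext ((daggerCls_ofOpOpCls _).trans (daggerCls_daggerCls y.2))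

variable (K A) in
/-- The standard duality, as a bijection between basic `τ`-rigid pairs over `Aᵒᵖ` and basic
`τ⁻`-rigid pairs over `A`. -/
def dualEquiv : tauRigidClasses K Aᵐᵒᵖ ≃ tauMinusRigidClasses K A where
  toFun y := ⟨ofOpOpCls (dualCls y.1), ofOpOpCls_dualCls_mem y.2⟩
  invFun z := ⟨dualCls z.1, dualCls_mem z.2⟩
  left_inv := fun ⟨y, hy⟩ => Subtype.ext (by
    induction y using Quotient.ind with
    | _ Y => exact Quotient.sound (dual_ofOpOp_dual_iso Y))
  right_inv := fun ⟨z, hz⟩ => Subtype.ext (by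
    induction z using Quotient.ind with
    | _ Z => exact Quotient.sound (ModPair.dual_dual_iso Z))

end Classes

end TauTilting

open TauTilting
theorem mainTheorem7 (K A : Type u) [Field K] [IsAlgClosed K] [Ring A] [Algebra K A]
    [Module.Finite K A] :
    -- the two descriptions of `(T, P)†` agree
    (∀ T P Tpr Tnp : FDMod K A, ModPair.IsTauRigid ⟨T, P⟩ → T.IsProjDecomp Tpr Tnp →
      ModPair.cls ⟨Tnp.tr.sum P.star, Tpr.star⟩ = ModPair.cls ⟨T.tr.sum P.star, Tpr.star⟩) ∧
    ∃ (Φ : tauRigidClasses K A ≃ tauRigidClasses K Aᵐᵒᵖ)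
      (Θ : tauRigidClasses K A ≃ tauMinusRigidClasses K A),
      -- `Φ` is the map `(T, P) ↦ (T, P)†`
      (∀ (x : tauRigidClasses K A) (T P Tpr Tnp : FDMod K A),
        ModPair.cls ⟨T, P⟩ = x.1 → T.IsProjDecomp Tpr Tnp →
          (Φ x).1 = ModPair.cls ⟨T.tr.sum P.star, Tpr.star⟩) ∧
      -- its inverse is the map `(-)†` for the opposite algebra, so `(-)†† = id`
      (∀ (y : tauRigidClasses K Aᵐᵒᵖ) (T P Tpr Tnp : FDMod K Aᵐᵒᵖ),
        ModPair.cls ⟨T, P⟩ = y.1 → T.IsProjDecomp Tpr Tnp →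
          (Φ.symm y).1 = ModPair.cls (ModPair.ofOpOp ⟨T.tr.sum P.star, Tpr.star⟩)) ∧
      -- `Φ` restricts to a bijection between support `τ`-tilting pairs
      Set.BijOn (fun x => Φ x) {x | x.1 ∈ supportTauTiltingClasses K A}
        {y | y.1 ∈ supportTauTiltingClasses K Aᵐᵒᵖ} ∧
      -- `Θ` is `Φ` followed by the standard duality, and its inverse is duality followed by `(-)†`
      (∀ (x : tauRigidClasses K A) (Y : ModPair K Aᵐᵒᵖ), Y.cls = (Φ x).1 →
        (Θ x).1 = Y.dual.ofOpOp.cls) ∧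
      (∀ (z : tauMinusRigidClasses K A) (Z : ModPair K A), Z.cls = z.1 →
        ∃ y : tauRigidClasses K Aᵐᵒᵖ, y.1 = Z.dual.cls ∧ Θ.symm z = Φ.symm y) ∧
      -- the explicit formulas for `Θ` and its inverse
      (∀ (x : tauRigidClasses K A) (X P Xpr Xnp : FDMod K A),
        ModPair.cls ⟨X, P⟩ = x.1 → X.IsProjDecomp Xpr Xnp →
          (Θ x).1 = ModPair.cls ⟨X.tau.sum P.nu, Xpr.nu⟩) ∧
      (∀ (z : tauMinusRigidClasses K A) (Y I Yin Yni : FDMod K A),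
        ModPair.cls ⟨Y, I⟩ = z.1 → Y.IsInjDecomp Yin Yni →
          (Θ.symm z).1 = ModPair.cls ⟨Y.tauMinus.sum I.nuMinus, Yin.nuMinus⟩) ∧
      -- `Θ` restricts to a bijection between support `τ`- and support `τ⁻`-tilting pairs
      Set.BijOn (fun x => Θ x) {x | x.1 ∈ supportTauTiltingClasses K A}
        {z | z.1 ∈ supportTauMinusTiltingClasses K A} := by
  refine ⟨fun T P Tpr Tnp _ h => ModPair.cls_eq_iff.2 ⟨h.tr_iso.symm.sum (FDMod.isoRefl _),
    FDMod.isoRefl _⟩, daggerEquiv K A, (daggerEquiv K A).trans (dualEquiv K A),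
    ?_, ?_, ?_, ?_, ?_, ?_, ?_, ?_⟩
  · intro x T P Tpr Tnp hx h
    exact (congrArg daggerCls hx).symm.trans (ModPair.cls_eq_iff.2 (ModPair.dagger_iso h))
  · intro y T P Tpr Tnp hy h
    exact (congrArg (fun c => ofOpOpCls (daggerCls c)) hy).symm.trans
      (ModPair.cls_eq_iff.2 (ModPair.dagger_iso h).ofOpOp)
  · exact (daggerEquiv K A).bijOn' (fun _ hx => daggerCls_mem_support hx)
      (fun _ hy => ofOpOpCls_mem_support (daggerCls_mem_support hy))
  · intro x Y hY
    exact (congrArg (fun c => ofOpOpCls (dualCls c)) hY).symm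
  · intro z Z hZ
    exact ⟨(dualEquiv K A).symm z, (congrArg dualCls hZ).symm, rfl⟩
  · intro x X P Xpr Xnp hx h
    exact (congrArg (fun c => ofOpOpCls (dualCls (daggerCls c))) hx).symm.trans
      (ModPair.cls_eq_iff.2 ((ModPair.dagger_iso h).dual.ofOpOp.trans
        ⟨(FDMod.dual_sum _ _).ofOpOp, FDMod.isoRefl _⟩))
  · intro z Y I Yin Yni hz h
    exact (congrArg (fun c => ofOpOpCls (daggerCls (dualCls c))) hz).symm.trans
      (ModPair.cls_eq_iff.2 (ModPair.dagger_iso (P := I.dual) h.dual).ofOpOp)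
  · exact ((daggerEquiv K A).trans (dualEquiv K A)).bijOn'
      (fun _ hx => ofOpOpCls_dualCls_mem_support (daggerCls_mem_support hx))
      (fun _ hz => ofOpOpCls_mem_support (daggerCls_mem_support (dualCls_mem_support hz)))
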